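/- **Setting.** Let $k$ be an infinite field, and let $P$ be a partition of $n\ge 0$. For $i\ge1$ let $n_i$ be the multiplicity of the part $i$ in $P$, and let $S_P=\{i : n_i\neq 0\}$. Let $V$ be the $k$-vector space with basis the $n$ vectors (vertices) $(u,i,m)$ with $i\in S_P$, $1\le u\le i$, $1\le m\le n_i$. The Jordan block matrix $J_P$ acts on it by $(u,i,m)\mapsto(u+1,i,m)$ if $u<i$ and $(i,i,m)\mapsto 0$. **The matrix $A_R$.** For $i\in S_P$ other than the smallest element $p_t$ of $S_P$, let $i^-$ be the largest element of $S_P$ smaller than $i$. Let $S_P''$ be the set of minimum elements of the maximal sets of consecutive integers contained in $S_P$ that have odd cardinality. Define endomorphisms, zero on all basis vectors not listed, by - $\beta_i:(u,i,n_i)\mapsto(u,i^-,1)$ and $\alpha_i:(u,i^-,n_{i^-})\mapsto(u+i-i^-,i,1)$ for $1\le u\le i^-$ (where $i\in S_P\setminus\{p_t\}$); - $e_{i,m}:(u,i,m)\mapsto(u,i,m+1)$ for $1\le u\le i$ (where $i\in S_P$, $1\le m<n_i$); - $w_\ell:(u,\ell,n_\ell)\mapsto(u+1,\ell,1)$ for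 $1\le u<\ell$ (where $\ell\in S_P''$). Let $R$ be the polynomial ring over $k$ in independent variables $s_i,t_i$ ($i\in S_P\setminus\{p_t\}$), $t_{j,m}$ ($j\in S_P$, $1\le m\le n_j$) and $z_\ell$ ($\ell\in S_P''$), and let $F$ be its quotient field. The simply adequate matrix is $$A_R=\sum_{i\in S_P\setminus\{p_t\}}(s_i\beta_i+t_i\alpha_i)+\sum_{i\in S_P}\ \sum_{1\le m<n_i}t_{i,m}e_{i,m}+\sum_{\ell\in S_P''}z_\ell w_\ell .$$ **The partition $\lambda_U(\mathcal D_P)$.** Let $s\ge 1$ and let $\mathfrak A=(a_1,\dots,a_s)$ have $a_i\in S_P$ and $a_i\ge a_{i+1}+2$ for $1\le i<s$. The $s$-$U$-chain of $\mathfrak A$ has as vertices all $(u,\ell,m)$ with $\ell\in\{a_1,a_1-1,\dots,a_s,a_s-1\}$, together with, for every other level $\ell\in S_P$ with $\ell>a_s$, all $(u,\ell,m)$ such that $u\le\#\{i: a_i<\ell\}$ or $u\ge \ell+1-\#\{i: a_i<\ell\}$. Let $u_s$ be the maximal number of vertices of an $s$-$U$-chain, and put $u_0=0$. Let $r_P$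 be the minimum number of almost rectangular subpartitions (largest and smallest part differing by at most one) into which $P$ decomposes. Then $\lambda_U(\mathcal D_P)$ has $i$-th part $u_i-u_{i-1}$ for $1\le i\le r_P$, and no further parts. **Statement.** Over $F$, the matrix $A_R$ is similar to a Jordan block matrix $J_Q$ for some partition $Q$ of $n$. Its Jordan partition $P_{A_R}=Q$ dominates $\lambda_U(\mathcal D_P)$: writing $Q=(q_1\ge q_2\ge\cdots)$ and $\lambda_U(\mathcal D_P)=(\lambda_1,\lambda_2,\dots)$, both extended by zeros, $$\sum_{j=1}^{i}q_j\ \ge\ \sum_{j=1}^{i}\lambda_j\qquad\text{for all } i\ge 1 .$$ -/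

import Mathlib

noncomputable section

namespace JordanPoset

open Finset

/-! ### Partitions and dominance -/

/-- The `k`-th part (`k = 1, 2, …`) of a partition, the parts being listed in decreasing order;
it is `0` beyond the last part. -/
def part {n : ℕ} (Q : n.Partition) (k : ℕ) : ℤ :=
  ((Q.parts.sort (fun a b => b ≤ a)).getD (k - 1) 0 : ℕ)

/-- The dominance order `p ≥ q` on sequences of parts indexed by `1, 2, …`. -/
def Dominates (p q : ℕ → ℤ) : Prop :=
  ∀ i : ℕ, ∑ k ∈ Icc 1 i, q k ≤ ∑ k ∈ Icc 1 i, p k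

/-- The set `S_P` of integers occurring as parts of `P`. -/
def levels {n : ℕ} (P : n.Partition) : Finset ℕ := P.parts.toFinset

/-- The multiplicity `n_i` of the part `i` in `P`. -/
def mult {n : ℕ} (P : n.Partition) (i : ℕ) : ℕ := P.parts.count i

/-- A multiset of integers is almost rectangular when its entries differ by at most one. -/
def AlmostRectangular (M : Multiset ℕ) : Prop := ∀ x ∈ M, ∀ y ∈ M, x ≤ y + 1

/-- `r_P`: the minimum number of almost rectangular subpartitions into which `P` decomposes. -/
def rP {n : ℕ} (P : n.Partition) : ℕ :=
  sInf {r | ∃ f : Fin r → Multiset ℕ, ∑ j, f j = P.parts ∧ ∀ j, AlmostRectangular (f j)}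

/-! ### The vertices `(u, i, k)` and the Jordan block matrix -/

/-- The vertices of the poset of `P`, that is the basis of `V`: the triples `(u, i, k)` with
`i ∈ S_P`, `1 ≤ u ≤ i` and `1 ≤ k ≤ n_i`. -/
def vertices {n : ℕ} (P : n.Partition) : Finset (ℕ × ℕ × ℕ) :=
  (levels P).biUnion fun i => Icc 1 i ×ˢ ({i} ×ˢ Icc 1 (mult P i))

theorem mem_vertices {n : ℕ} (P : n.Partition) (u i k : ℕ) :
    (u, i, k) ∈ vertices P ↔ i ∈ levels P ∧ (1 ≤ u ∧ u ≤ i) ∧ 1 ≤ k ∧ k ≤ mult P i := by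
  simp only [vertices, mem_biUnion, mem_product, mem_singleton, mem_Icc]
  constructor
  · rintro ⟨j, hj, hu, rfl, hk⟩
    exact ⟨hj, hu, hk⟩
  · rintro ⟨hi, hu, hk⟩
    exact ⟨i, hi, hu, rfl, hk⟩

/-- The index type of the basis. -/
abbrev Vertex {n : ℕ} (P : n.Partition) : Type := ↥(vertices P)

open Classical in
/-- The endomorphism sending a basis vector `v` to the sum of the basis vectors `v'` with
`E v v'`, in the convention that column `v` of the matrix holds the image of `v`. In all uses below
there is at most one such `v'`. -/
def edgeMatrix {n : ℕ} (P : n.Partition) (K : Type*) [Semiring K]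
    (E : ℕ × ℕ × ℕ → ℕ × ℕ × ℕ → Prop) : Matrix (Vertex P) (Vertex P) K :=
  Matrix.of fun v' v => if E v.1 v'.1 then 1 else 0

/-- The nilpotent Jordan block matrix `J_P`: `(u, i, k) ↦ (u + 1, i, k)` for `u < i`, and
`(i, i, k) ↦ 0`. -/
def jordanMatrix {n : ℕ} (P : n.Partition) (K : Type*) [Semiring K] :
    Matrix (Vertex P) (Vertex P) K :=
  edgeMatrix P K fun v v' => v' = (v.1 + 1, v.2.1, v.2.2)

/-- The square matrix `A` has Jordan type `Q`: in a suitable basis it becomes the Jordan block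
matrix `J_Q`. -/
def HasJordanType {K ι : Type*} [Field K] [Fintype ι] (A : Matrix ι ι K) {n : ℕ}
    (Q : n.Partition) : Prop :=
  ∃ e : (ι → K) ≃ₗ[K] (Vertex Q → K), ∀ x, e (A.mulVec x) = (jordanMatrix Q K).mulVec (e x)

/-! ### Elementary maps -/

/-- `S_P` without its smallest element `p_t`. -/
def upperLevels {n : ℕ} (P : n.Partition) : Finset ℕ :=
  (levels P).filter fun i => ∃ j ∈ levels P, j < i

/-- `i⁻`, the largest element of `S_P` smaller than `i`. -/
def pred {n : ℕ} (P : n.Partition) (i : ℕ) : ℕ :=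
  ((levels P).filter fun j => j < i).sup id

/-- A nonempty set of consecutive integers. -/
def IsConsecutive (C : Finset ℕ) : Prop := ∃ a b : ℕ, a ≤ b ∧ C = Icc a b

/-- A maximal consecutive subsequence of `S`. -/
def IsMCS (S C : Finset ℕ) : Prop := Maximal (fun D => D ⊆ S ∧ IsConsecutive D) C

open Classical in
/-- `S_P''`: the minimum elements of the maximal consecutive subsequences of `S_P` that have odd
cardinality. -/
def oddMinima {n : ℕ} (P : n.Partition) : Finset ℕ :=
  (levels P).filter fun l =>
    ∃ C : Finset ℕ, IsMCS (levels P) C ∧ Odd C.card ∧ IsLeast (C : Set ℕ) l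

/-- `β_i` : `(u, i, n_i) ↦ (u, i⁻, 1)` for `1 ≤ u ≤ i⁻`. -/
def betaMap {n : ℕ} (P : n.Partition) (K : Type*) [Semiring K] (i : ℕ) :
    Matrix (Vertex P) (Vertex P) K :=
  edgeMatrix P K fun v v' => ∃ u, 1 ≤ u ∧ u ≤ pred P i ∧
    v = (u, i, mult P i) ∧ v' = (u, pred P i, 1)

/-- `α_i` : `(u, i⁻, n_{i⁻}) ↦ (u + i - i⁻, i, 1)` for `1 ≤ u ≤ i⁻` (here `i⁻ < i`). -/
def alphaMap {n : ℕ} (P : n.Partition) (K : Type*) [Semiring K] (i : ℕ) :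
    Matrix (Vertex P) (Vertex P) K :=
  edgeMatrix P K fun v v' => ∃ u, 1 ≤ u ∧ u ≤ pred P i ∧
    v = (u, pred P i, mult P (pred P i)) ∧ v' = (u + (i - pred P i), i, 1)

/-- `e_{i,k}` : `(u, i, k) ↦ (u, i, k + 1)` for `1 ≤ u ≤ i`; used for `1 ≤ k < n_i`. -/
def eMap {n : ℕ} (P : n.Partition) (K : Type*) [Semiring K] (i k : ℕ) :
    Matrix (Vertex P) (Vertex P) K :=
  edgeMatrix P K fun v v' => ∃ u, 1 ≤ u ∧ u ≤ i ∧ v = (u, i, k) ∧ v' = (u, i, k + 1)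

/-- `w_l` : `(u, l, n_l) ↦ (u + 1, l, 1)` for `1 ≤ u < l`. -/
def wMap {n : ℕ} (P : n.Partition) (K : Type*) [Semiring K] (l : ℕ) :
    Matrix (Vertex P) (Vertex P) K :=
  edgeMatrix P K fun v v' => ∃ u, 1 ≤ u ∧ u < l ∧ v = (u, l, mult P l) ∧ v' = (u + 1, l, 1)

/-! ### The simply adequate matrix -/

/-- The variables `s_i`, `t_i` (`i ∈ S_P`, `i ≠ p_t`), `t_{j,k}` (`j ∈ S_P`, `1 ≤ k ≤ n_j`) and
`z_l` (`l ∈ S_P''`). -/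
inductive Var {n : ℕ} (P : n.Partition) : Type
  | s (i : upperLevels P) : Var P
  | t (i : upperLevels P) : Var P
  | tt (j : levels P) (k : Icc 1 (mult P j)) : Var P
  | z (l : oddMinima P) : Var P

/-- The polynomial ring `R = k[s_i, t_i, t_{j,k}, z_l]`. -/
abbrev PolyRing {n : ℕ} (P : n.Partition) (k : Type*) [Field k] : Type _ := MvPolynomial (Var P) k

/-- The simply adequate matrix
`A_R = ∑ (s_i β_i + t_i α_i) + ∑ t_{i,k} e_{i,k} + ∑ z_l w_l`, the middle sum running over
`i ∈ S_P` and `1 ≤ k < n_i`. -/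
def simplyAdequate {n : ℕ} (P : n.Partition) (k : Type*) [Field k] :
    Matrix (Vertex P) (Vertex P) (PolyRing P k) :=
  ∑ i : upperLevels P, ((MvPolynomial.X (Var.s i) : PolyRing P k) • betaMap P (PolyRing P k) i
      + (MvPolynomial.X (Var.t i) : PolyRing P k) • alphaMap P (PolyRing P k) i)
    + ∑ i : levels P, ∑ m : Icc 1 (mult P i), (if (m : ℕ) < mult P i then
        (MvPolynomial.X (Var.tt i m) : PolyRing P k) • eMap P (PolyRing P k) i m else 0)
    + ∑ l : oddMinima P, (MvPolynomial.X (Var.z l) : PolyRing P k) • wMap P (PolyRing P k) l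

/-- The simply adequate matrix, viewed over the quotient field `F` of `R`. -/
def simplyAdequateFrac {n : ℕ} (P : n.Partition) (k : Type*) [Field k] :
    Matrix (Vertex P) (Vertex P) (FractionRing (PolyRing P k)) :=
  (simplyAdequate P k).map (algebraMap (PolyRing P k) (FractionRing (PolyRing P k)))

/-! ### `s`-`U`-chains and the partition `λ_U` -/

/-- The tuples `(a_1, …, a_s)` of elements of `S_P` with `a_i ≥ a_{i+1} + 2`. -/
def IsUTuple {n : ℕ} (P : n.Partition) {s : ℕ} (a : Fin s → ℕ) : Prop :=
  (∀ i, a i ∈ levels P) ∧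
    ∀ (i : ℕ) (h : i + 1 < s), a ⟨i + 1, h⟩ + 2 ≤ a ⟨i, (Nat.lt_succ_self i).trans h⟩

/-- The number `#{i | a_i < l}`. -/
def numBelow {s : ℕ} (a : Fin s → ℕ) (l : ℕ) : ℕ := (univ.filter fun i => a i < l).card

/-- The vertex set of the `s`-`U`-chain of `(a_1, …, a_s)`: all vertices at the levels `a_i` and
`a_i - 1` and, at every other level `l > a_s = min a_i`, the vertices `(u, l, k)` with
`u ≤ #{i | a_i < l}` or `u ≥ l + 1 - #{i | a_i < l}`. -/
def uChain {n : ℕ} (P : n.Partition) {s : ℕ} (a : Fin s → ℕ) : Finset (ℕ × ℕ × ℕ) :=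
  (vertices P).filter fun v =>
    (∃ i, v.2.1 = a i ∨ v.2.1 + 1 = a i) ∨
    ((∃ i, a i < v.2.1) ∧ (v.1 ≤ numBelow a v.2.1 ∨ v.2.1 + 1 ≤ v.1 + numBelow a v.2.1))

open Classical in
/-- `u_s`: the maximal number of vertices of an `s`-`U`-chain (and `u_0 = 0`). -/
def uMax {n : ℕ} (P : n.Partition) (s : ℕ) : ℕ :=
  ((Fintype.piFinset fun _ : Fin s => levels P).filter fun a => IsUTuple P a).sup
    fun a => (uChain P a).card

/-- The parts of `λ_U`: the `i`-th part is `u_i - u_{i-1}` for `1 ≤ i ≤ r_P`, and there are no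
further parts. -/
def lambdaU {n : ℕ} (P : n.Partition) (i : ℕ) : ℤ :=
  if 1 ≤ i ∧ i ≤ rP P then (uMax P i : ℤ) - (uMax P (i - 1) : ℤ) else 0

end JordanPoset

end

/-!
Over a field `K`, let `A` be a nilpotent matrix of Jordan type `Q` and `R` a matrix of rank at most
`s`. A submodule generated over `K[A]` by `s` elements has dimension at most `q_1 + ⋯ + q_s`
(`HasJordanType.finrank_orbitSpan_le`). Applied to the submodule generated by the image of `R`,
modulo which `A + R` and `A` agree, this shows that the characteristic polynomial of `-(A + R)` of
size `n` vanishes at `0` to order at least `n - (q_1 + ⋯ + q_s)`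
(`HasJordanType.card_le_natTrailingDegree_add`). So it suffices to find, for each `s`-`U`-chain
with vertex set `U`, a matrix `R` of rank at most `s` such that the coefficient of `X ^ (n - |U|)`
in this polynomial is nonzero when `A = A_R` is the simply adequate matrix.

The `U`-chain may be enlarged so that each `a_i` either has the level `a_i - 1` below it or carries
the loop `w_{a_i}` (`IsUTuple.exists_good`): an entry that starts an even run of levels is raised by
one, together with the entries just above it. Such a chain is covered by `s` disjoint paths of
`A_R`. They start in the `s` lowest rows of the top level, descend along the `β`'s, turn back at the
levels `a_i` (zigzagging between `a_i` and `a_i - 1`, or winding along `w_{a_i}`) and ascend along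
the `α`'s to the `s` highest rows of the top level. Take for `R` the matrix that leads from the ends
of the paths back to their starts. By the Leibniz expansion the coefficient in question is a sum of
signed monomials in the variables of `A_R`, one for each permutation of `|U|` vertices whose steps
are edges or return steps.

The variables do not depend on the row `u`, so several permutations might share a monomial. They do
not (`PathSystem.unique`): fix an upper level `i` and sum over all steps the increase of the
function that is `u` on the levels `≥ i` and `0` below. The total is zero, and apart from the rows
in which `β_i`, `α_i` and the return steps are used, it depends only on the monomial. Hence the
sum of the rows used by `α_i` minus that of the rows used by `β_i` is determined by the monomial.
The path system has this difference as large as possible, with `β_i` in the lowest rows and `α_i` in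
the highest, so every permutation with the same monomial uses the same rows and agrees with it. The
coefficient of this monomial is therefore `±1`, over any field.

The Jordan type exists because `A_R` is nilpotent: its edges increase the vertices lexicographically
in `2u - l` and the position in the row.
-/

namespace JordanPoset

open Finset

/-! ### Submodules generated by few vectors -/

section LinearAlgebra

variable {K V : Type*} [Field K] [AddCommGroup V] [Module K V]

theorem finrank_le_finrank_map_add [FiniteDimensional K V] (A : V →ₗ[K] V) (W : Submodule K V) :
    Module.finrank K W ≤
      Module.finrank K (W.map A) + Module.finrank K (LinearMap.ker A ⊓ W : Submodule K V) := by
  have h := LinearMap.finrank_range_add_finrank_ker (A.domRestrict W)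
  rw [LinearMap.range_domRestrict] at h
  rw [← h]
  gcongr
  rw [← Submodule.finrank_map_subtype_eq W]
  refine Submodule.finrank_mono ?_
  rintro _ ⟨x, hx, rfl⟩
  exact ⟨hx, x.2⟩

/-- A submodule generated over `K[A]` by a subspace `G` of dimension at most `s` has
dimension at most `∑ⱼ min s (dim (ker A ∩ im Aʲ))`; the `j`-th summand bounds the dimension of
`AʲN / Aʲ⁺¹N`. -/
theorem finrank_le_sum_min [FiniteDimensional K V] (A : V →ₗ[K] V) (N G : Submodule K V) (s m : ℕ)
    (hG : Module.finrank K G ≤ s) (hN : N ≤ G ⊔ N.map A) (hm : A ^ m = 0) :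
    Module.finrank K N ≤ ∑ j ∈ range m,
      min s (Module.finrank K (LinearMap.ker A ⊓ LinearMap.range (A ^ j) : Submodule K V)) := by
  have step : ∀ j, Module.finrank K (N.map (A ^ j)) ≤ Module.finrank K (N.map (A ^ (j + 1))) +
      min s (Module.finrank K (LinearMap.ker A ⊓ LinearMap.range (A ^ j) : Submodule K V)) := by
    intro j
    rw [← min_add_add_left]
    refine le_min ?_ ?_
    · have h1 : N.map (A ^ j) ≤ N.map (A ^ (j + 1)) ⊔ G.map (A ^ j) := by
        refine (Submodule.map_mono hN).trans ?_
        rw [Submodule.map_sup, sup_comm, ← Submodule.map_comp, pow_succ]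
        rfl
      have h2 := Submodule.finrank_mono h1
      have h3 := Submodule.finrank_add_le_finrank_add_finrank (N.map (A ^ (j + 1))) (G.map (A ^ j))
      have h4 := Submodule.finrank_map_le (A ^ j) G
      omega
    · have h1 := finrank_le_finrank_map_add A (N.map (A ^ j))
      rw [← Submodule.map_comp] at h1
      rw [pow_succ']
      refine h1.trans ?_
      gcongr
      · exact le_rfl
      · exact Submodule.finrank_mono (inf_le_inf_left _ LinearMap.map_le_range)
  have total : ∀ m, Module.finrank K N ≤ Module.finrank K (N.map (A ^ m)) + ∑ j ∈ range m,
      min s (Module.finrank K (LinearMap.ker A ⊓ LinearMap.range (A ^ j) : Submodule K V)) := by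
    intro m
    induction m with
    | zero => rw [pow_zero, Module.End.one_eq_id, Submodule.map_id]; simp
    | succ m ih =>
      rw [sum_range_succ]
      have := step m
      omega
  have := total m
  rw [hm, Submodule.map_zero, finrank_bot, zero_add] at this
  exact this

/-- The subspace spanned by all `Aʲ g` with `g ∈ G`. -/
def orbitSpan (A : V →ₗ[K] V) (G : Submodule K V) : Submodule K V := ⨆ j : ℕ, G.map (A ^ j)

theorem orbitSpan_le (A : V →ₗ[K] V) (G : Submodule K V) :
    orbitSpan A G ≤ G ⊔ (orbitSpan A G).map A := by
  refine iSup_le fun j => ?_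
  cases j with
  | zero => exact le_sup_of_le_left (by simp [pow_zero, Module.End.one_eq_id])
  | succ j =>
    refine le_sup_of_le_right ?_
    rw [pow_succ', Module.End.mul_eq_comp, Submodule.map_comp]
    exact Submodule.map_mono (le_iSup (fun j : ℕ => G.map (A ^ j)) j)

theorem map_orbitSpan_le (A : V →ₗ[K] V) (G : Submodule K V) :
    (orbitSpan A G).map A ≤ orbitSpan A G := by
  rw [orbitSpan, Submodule.map_iSup]
  refine iSup_le fun j => ?_
  rw [← Submodule.map_comp, ← Module.End.mul_eq_comp, ← pow_succ']
  exact le_iSup (fun j : ℕ => G.map (A ^ j)) (j + 1)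

/-- A perturbation `R` of a nilpotent `A` whose image generates a submodule `N` stays nilpotent on
`V / N`. Hence the characteristic polynomial of `-(A + R)` is divisible by `X ^ (dim V - dim N)`. -/
theorem finrank_le_natTrailingDegree_add [FiniteDimensional K V] (A R : V →ₗ[K] V) (m : ℕ)
    (hm : A ^ m = 0) :
    Module.finrank K V ≤ (-(A + R)).charpoly.natTrailingDegree +
      Module.finrank K (orbitSpan A (LinearMap.range R)) := by
  set N := orbitSpan A (LinearMap.range R) with hN
  have hR : ∀ x, R x ∈ N := fun x => by
    refine (le_iSup (fun j : ℕ => (LinearMap.range R).map (A ^ j)) 0) ?_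
    exact ⟨R x, ⟨x, rfl⟩, by simp⟩
  have hA : ∀ x ∈ N, A x ∈ N := fun x hx => map_orbitSpan_le A _ ⟨x, hx, rfl⟩
  have hdiff : ∀ j x, ((A + R) ^ j) x - (A ^ j) x ∈ N := by
    intro j
    induction j with
    | zero => intro x; simp
    | succ j ih =>
      intro x
      have : ((A + R) ^ (j + 1)) x - (A ^ (j + 1)) x =
          A (((A + R) ^ j) x - (A ^ j) x) + R (((A + R) ^ j) x) := by
        simp only [pow_succ', Module.End.mul_apply, LinearMap.add_apply, map_sub]
        abel
      rw [this]
      exact N.add_mem (hA _ (ih x)) (hR _)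
  have hrange : LinearMap.range ((-(A + R)) ^ m) ≤ N := by
    rintro _ ⟨x, rfl⟩
    rw [neg_pow]
    have := hdiff m x
    rw [hm] at this
    simp only [LinearMap.zero_apply, sub_zero] at this
    rcases neg_one_pow_eq_or (Module.End K V) m with h | h <;> rw [h]
    · simpa using this
    · simpa using this
  have h1 := LinearMap.finrank_range_add_finrank_ker ((-(A + R)) ^ m)
  have h2 := Submodule.finrank_mono hrange
  have h3 : Module.finrank K (LinearMap.ker ((-(A + R)) ^ m)) ≤
      Module.finrank K (Module.End.maxGenEigenspace (-(A + R)) 0) := by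
    refine Submodule.finrank_mono fun x hx => ?_
    rw [Module.End.mem_maxGenEigenspace]
    exact ⟨m, by simpa using hx⟩
  rw [LinearMap.finrank_maxGenEigenspace_zero_eq] at h3
  omega

end LinearAlgebra

/-! ### Sums of the largest parts -/

theorem min_countP_le_countP_take (j : ℕ) (L : List ℕ) (hL : L.Pairwise (fun a b => b ≤ a))
    (s : ℕ) : min s (L.countP (j < ·)) ≤ (L.take s).countP (j < ·) := by
  induction L generalizing s with
  | nil => simp
  | cons x L ih =>
    rw [List.pairwise_cons] at hL
    cases s with
    | zero => simp
    | succ s =>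
      have := ih hL.2 s
      rw [List.take_succ_cons, List.countP_cons, List.countP_cons]
      by_cases hx : j < x
      · simp only [hx, decide_true, if_true]
        omega
      · have h0 : L.countP (j < ·) = 0 := by
          rw [List.countP_eq_zero]
          intro a ha
          have := hL.1 a ha
          simp only [decide_eq_true_eq]
          omega
        simp [hx, h0]

theorem sum_countP_le_sum (m : ℕ) (L : List ℕ) :
    ∑ j ∈ range m, L.countP (j < ·) ≤ L.sum := by
  induction L with
  | nil => simp
  | cons x L ih =>
    simp only [List.countP_cons, sum_add_distrib, List.sum_cons, decide_eq_true_eq]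
    have : ∑ j ∈ range m, (if j < x then 1 else 0) ≤ x := by
      rw [← card_filter]
      calc _ ≤ (range x).card := card_le_card fun j hj => by
            simp only [mem_filter] at hj
            exact mem_range.2 hj.2
        _ = x := card_range x
    omega

theorem sum_getD_eq_sum_take (L : List ℕ) (s : ℕ) :
    ∑ k ∈ Icc 1 s, L.getD (k - 1) 0 = (L.take s).sum := by
  induction s with
  | zero => simp
  | succ s ih =>
    rw [sum_Icc_succ_top (by omega), ih, List.take_add_one, List.sum_append, Nat.add_sub_cancel,
      List.getD_eq_getElem?_getD]
    cases L[s]? <;> simp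

theorem sum_part_eq {n : ℕ} (Q : n.Partition) (s : ℕ) : ∑ k ∈ Icc 1 s, part Q k =
    (((Q.parts.sort (fun a b => b ≤ a)).take s).sum : ℕ) := by
  rw [← sum_getD_eq_sum_take, Nat.cast_sum]
  rfl

/-- `∑ⱼ min s #{parts > j}` is at most the sum of the `s` largest parts: the columns of the Young
diagram of `Q`, cut off at height `s`. -/
theorem sum_min_countP_le_sum_part {n : ℕ} (Q : n.Partition) (s m : ℕ) :
    ((∑ j ∈ range m, min s (Q.parts.countP (j < ·)) : ℕ) : ℤ) ≤ ∑ k ∈ Icc 1 s, part Q k := by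
  rw [sum_part_eq, Nat.cast_le]
  refine le_trans (sum_le_sum fun j _ => ?_) (sum_countP_le_sum m _)
  have h := min_countP_le_countP_take j _
    (Q.parts.pairwise_sort (fun a b : ℕ => b ≤ a)) s
  rw [← Multiset.coe_countP, Multiset.sort_eq] at h
  exact h

/-! ### Kernel and powers of a Jordan block matrix -/

theorem sum_mult_filter {n : ℕ} (Q : n.Partition) (j : ℕ) :
    ∑ l ∈ (levels Q).filter (j < ·), mult Q l = Q.parts.countP (j < ·) := by
  rw [Multiset.countP_eq_card_filter, ← Multiset.toFinset_sum_count_eq, Multiset.toFinset_filter]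
  refine sum_congr rfl fun l hl => ?_
  rw [Multiset.count_filter_of_pos (mem_filter.1 hl).2]
  rfl

theorem mem_vertices_iff {n : ℕ} (P : n.Partition) (v : ℕ × ℕ × ℕ) :
    v ∈ vertices P ↔ v.2.1 ∈ levels P ∧ (1 ≤ v.1 ∧ v.1 ≤ v.2.1) ∧
      1 ≤ v.2.2 ∧ v.2.2 ≤ mult P v.2.1 :=
  mem_vertices P v.1 v.2.1 v.2.2

theorem Vertex.bounds {n : ℕ} {P : n.Partition} (v : Vertex P) :
    v.1.2.1 ∈ levels P ∧ (1 ≤ v.1.1 ∧ v.1.1 ≤ v.1.2.1) ∧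
      1 ≤ v.1.2.2 ∧ v.1.2.2 ≤ mult P v.1.2.1 :=
  (mem_vertices_iff P v.1).1 v.2

theorem jordanMatrix_mulVec {K : Type*} [Field K] {n : ℕ} (Q : n.Partition) (x : Vertex Q → K)
    (v v' : Vertex Q) (h : v'.1 = (v.1.1 + 1, v.1.2.1, v.1.2.2)) :
    (jordanMatrix Q K).mulVec x v' = x v := by
  rw [Matrix.mulVec, dotProduct, Finset.sum_eq_single v]
  · simp [jordanMatrix, edgeMatrix, h]
  · intro w _ hw
    have : ¬ v'.1 = (w.1.1 + 1, w.1.2.1, w.1.2.2) := fun h' => hw <| Subtype.ext <| by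
      rw [h] at h'
      simp only [Prod.mk.injEq, add_left_inj] at h'
      exact Prod.ext h'.1.symm (Prod.ext h'.2.1.symm h'.2.2.symm)
    simp [jordanMatrix, edgeMatrix, this]
  · simp

theorem jordanMatrix_mulVec_of_fst_le_one {K : Type*} [Field K] {n : ℕ} (Q : n.Partition)
    (x : Vertex Q → K) (v' : Vertex Q) (h : v'.1.1 ≤ 1) :
    (jordanMatrix Q K).mulVec x v' = 0 := by
  rw [Matrix.mulVec, dotProduct, Finset.sum_eq_zero]
  intro w _
  have : ¬ v'.1 = (w.1.1 + 1, w.1.2.1, w.1.2.2) := fun h' => by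
    have h1 := congrArg Prod.fst h'
    have h2 := w.bounds.2.1.1
    simp only at h1
    omega
  simp [jordanMatrix, edgeMatrix, this]

theorem finrank_le_card_of_support {K ι : Type*} [Field K] [Fintype ι] {G : Submodule K (ι → K)}
    (T : Finset ι) (hG : ∀ x ∈ G, ∀ v ∉ T, x v = 0) : Module.finrank K G ≤ T.card := by
  have hinj : Function.Injective
      ((LinearMap.funLeft K K (Subtype.val : T → ι)).domRestrict G) := by
    rw [injective_iff_map_eq_zero]
    rintro ⟨x, hx⟩ h
    refine Subtype.ext (funext fun v => ?_)
    by_cases hv : v ∈ T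
    · exact congrFun h ⟨v, hv⟩
    · exact hG x hx v hv
  have := LinearMap.finrank_le_finrank_of_injective hinj
  simpa using this

theorem finrank_ker_inf_range_jordanMatrix_le (K : Type*) [Field K] {n : ℕ} (Q : n.Partition)
    (j : ℕ) : Module.finrank K (LinearMap.ker (jordanMatrix Q K).mulVecLin ⊓
      LinearMap.range ((jordanMatrix Q K).mulVecLin ^ j) : Submodule K (Vertex Q → K)) ≤
      Q.parts.countP (j < ·) := by
  set J := (jordanMatrix Q K).mulVecLin with hJ
  set T : Finset (Vertex Q) := univ.filter fun v => v.1.1 = v.1.2.1 ∧ j < v.1.2.1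
  have hrange : ∀ (i : ℕ) (x : Vertex Q → K) (v : Vertex Q), v.1.1 ≤ i → (J ^ i) x v = 0 := by
    intro i
    induction i with
    | zero =>
      intro x v hv
      have := v.bounds.2.1.1
      omega
    | succ i ih =>
      intro x v hv
      rw [pow_succ', Module.End.mul_apply, hJ, Matrix.mulVecLin_apply, ← hJ]
      by_cases h1 : v.1.1 ≤ 1
      · exact jordanMatrix_mulVec_of_fst_le_one Q _ v h1
      · have hv' := v.bounds
        have hw : (v.1.1 - 1, v.1.2.1, v.1.2.2) ∈ vertices Q :=
          (mem_vertices Q _ _ _).2 ⟨hv'.1, by omega, hv'.2.2⟩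
        rw [jordanMatrix_mulVec Q _ ⟨_, hw⟩ v (Prod.ext (by simp only; omega) rfl)]
        exact ih x _ (by simp only; omega)
  have hsupp : ∀ x ∈ LinearMap.ker J ⊓ LinearMap.range (J ^ j), ∀ v ∉ T, x v = 0 := by
    rintro x ⟨hx, y, rfl⟩ v hv
    by_cases h1 : v.1.1 ≤ j
    · exact hrange j y v h1
    · have hv' := v.bounds
      simp only [T, mem_filter, mem_univ, true_and] at hv
      have hw : (v.1.1 + 1, v.1.2.1, v.1.2.2) ∈ vertices Q :=
        (mem_vertices Q _ _ _).2 ⟨hv'.1, by omega, hv'.2.2⟩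
      rw [← jordanMatrix_mulVec Q ((J ^ j) y) v ⟨_, hw⟩ rfl]
      exact congrFun (LinearMap.mem_ker.1 hx) _
  have hcard : T.card ≤ Q.parts.countP (j < ·) := by
    rw [← sum_mult_filter]
    calc T.card ≤ (((levels Q).filter (j < ·)).sigma fun l => Icc 1 (mult Q l)).card := by
          refine card_le_card_of_injOn (fun v => ⟨v.1.2.1, v.1.2.2⟩) ?_ ?_
          · intro v hv
            have hv' := v.bounds
            simp only [T, coe_filter, mem_univ, true_and, Set.mem_ofPred_eq] at hv
            simp only [coe_sigma, Set.mem_sigma_iff, mem_coe, mem_filter, mem_Icc]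
            exact ⟨⟨hv'.1, hv.2⟩, hv'.2.2⟩
          · intro v hv w hw h
            simp only [T, coe_filter, mem_univ, true_and, Set.mem_ofPred_eq] at hv hw
            simp only [Sigma.mk.injEq, heq_eq_eq] at h
            exact Subtype.ext (Prod.ext (by omega) (Prod.ext h.1 h.2))
      _ = _ := by simp
  refine le_trans ?_ hcard
  exact finrank_le_card_of_support T hsupp

/-- A subspace `G` of dimension at most `s` generates, under a nilpotent matrix of Jordan type `Q`,
a submodule whose dimension is at most the sum of the `s` largest parts of `Q`. -/
theorem HasJordanType.finrank_orbitSpan_le {K ι : Type*} [Field K] [Fintype ι] {A : Matrix ι ι K}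
    {n : ℕ} {Q : n.Partition} (hA : HasJordanType A Q) (m : ℕ) (hm : A.mulVecLin ^ m = 0)
    (G : Submodule K (ι → K)) (s : ℕ) (hG : Module.finrank K G ≤ s) :
    (Module.finrank K (orbitSpan A.mulVecLin G) : ℤ) ≤ ∑ k ∈ Icc 1 s, part Q k := by
  obtain ⟨e, he⟩ := hA
  have h1 := finrank_le_sum_min A.mulVecLin _ G s m hG (orbitSpan_le _ _) hm
  refine le_trans ?_ (sum_min_countP_le_sum_part Q s m)
  rw [Nat.cast_le]
  refine h1.trans (sum_le_sum fun j _ => min_le_min_left s ?_)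
  refine le_trans ?_ (finrank_ker_inf_range_jordanMatrix_le K Q j)
  rw [← LinearEquiv.finrank_map_eq e]
  refine Submodule.finrank_mono ?_
  have hpow : ∀ j x, e ((A.mulVecLin ^ j) x) = ((jordanMatrix Q K).mulVecLin ^ j) (e x) := by
    intro j
    induction j with
    | zero => intro x; simp
    | succ j ih =>
      intro x
      rw [pow_succ', pow_succ', Module.End.mul_apply, Module.End.mul_apply, ← ih]
      exact he _
  rintro _ ⟨x, ⟨hx, y, hy⟩, rfl⟩
  refine ⟨?_, e y, ?_⟩
  · rw [SetLike.mem_coe, LinearMap.mem_ker] at hx ⊢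
    have := he x
    rw [← Matrix.mulVecLin_apply, hx, map_zero] at this
    exact this.symm
  · rw [← hpow, hy]
    rfl

/-! ### Existence of the Jordan type -/

theorem card_vertices {n : ℕ} (P : n.Partition) : (vertices P).card = n := by
  rw [vertices, card_biUnion]
  · simp only [card_product, Nat.card_Icc, card_singleton, add_tsub_cancel_right, one_mul]
    conv_rhs => rw [← P.parts_sum, sum_multiset_count]
    exact sum_congr rfl fun l _ => by rw [smul_eq_mul, mul_comm]; rfl
  · intro i _ j _ hij
    rw [Function.onFun, disjoint_left]
    intro v hv hv'
    simp only [mem_product, mem_singleton] at hv hv'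
    exact hij (hv.2.1.symm.trans hv'.2.1)

/-- A nilpotent endomorphism `A` makes the space a direct sum of cyclic modules
`K[X] / (X ^ c i)`, with generators `g i`. -/
theorem exists_cyclic_decomposition {K V : Type*} [Field K] [AddCommGroup V] [Module K V]
    [FiniteDimensional K V] (A : V →ₗ[K] V) (m : ℕ) (hm : A ^ m = 0) :
    ∃ (d : ℕ) (c : Fin d → ℕ) (g : Fin d → V),
      (∀ p : Fin d → Polynomial K, ∑ i, Polynomial.aeval A (p i) (g i) = 0 ↔
        ∀ i, Polynomial.X ^ c i ∣ p i) ∧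
      ∀ x, ∃ p : Fin d → Polynomial K, x = ∑ i, Polynomial.aeval A (p i) (g i) := by
  classical
  have htors : Module.IsTorsion' (Module.AEval' A)
      (Submonoid.powers (Polynomial.X : Polynomial K)) := by
    intro x
    obtain ⟨y, rfl⟩ := (Module.AEval'.of A).surjective x
    refine ⟨⟨Polynomial.X ^ m, m, rfl⟩, ?_⟩
    show (Polynomial.X ^ m : Polynomial K) • Module.AEval'.of A y = 0
    rw [Module.AEval'.X_pow_smul_of, hm]
    simp
  obtain ⟨d, c, ⟨φ⟩⟩ := Module.torsion_by_prime_power_decomposition Polynomial.irreducible_X htors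
  have key : ∀ p : Fin d → Polynomial K, φ (∑ i, p i • φ.symm (DirectSum.lof (Polynomial K) (Fin d)
      (fun i => Polynomial K ⧸ Submodule.span (Polynomial K) {(Polynomial.X : Polynomial K) ^ c i})
      i (Submodule.Quotient.mk 1))) = ∑ i, DirectSum.lof (Polynomial K) (Fin d) _ i
        (Submodule.Quotient.mk (p i)) := by
    intro p
    rw [map_sum]
    refine sum_congr rfl fun i _ => ?_
    rw [map_smul, LinearEquiv.apply_symm_apply, ← map_smul, ← Submodule.Quotient.mk_smul,
      smul_eq_mul, mul_one]
  have hof : ∀ p : Fin d → Polynomial K, Module.AEval'.of A (∑ i, Polynomial.aeval A (p i)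
      ((Module.AEval'.of A).symm (φ.symm (DirectSum.lof (Polynomial K) (Fin d)
      (fun i => Polynomial K ⧸ Submodule.span (Polynomial K) {(Polynomial.X : Polynomial K) ^ c i})
      i (Submodule.Quotient.mk 1))))) = ∑ i, p i • φ.symm (DirectSum.lof (Polynomial K) (Fin d)
      (fun i => Polynomial K ⧸ Submodule.span (Polynomial K) {(Polynomial.X : Polynomial K) ^ c i})
      i (Submodule.Quotient.mk 1)) := by
    intro p
    rw [map_sum]
    refine sum_congr rfl fun i _ => ?_
    exact Module.AEval.of_aeval_smul (R := K) (a := A) (p i) _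
  refine ⟨d, c, fun i => (Module.AEval'.of A).symm (φ.symm (DirectSum.lof (Polynomial K) (Fin d)
      (fun i => Polynomial K ⧸ Submodule.span (Polynomial K) {(Polynomial.X : Polynomial K) ^ c i})
      i (Submodule.Quotient.mk 1))), ?_, ?_⟩
  · intro p
    rw [← (Module.AEval'.of A).map_eq_zero_iff, ← φ.map_eq_zero_iff, hof, key]
    constructor
    · intro h i
      have h1 := congrArg (DirectSum.component (Polynomial K) (Fin d) _ i) h
      rw [map_sum, Finset.sum_eq_single i, DirectSum.component.lof_self, map_zero,
        Submodule.Quotient.mk_eq_zero] at h1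
      · exact Ideal.mem_span_singleton.1 h1
      · intro j _ hj
        rw [DirectSum.component.of, dif_neg hj]
      · simp
    · intro h
      refine Finset.sum_eq_zero fun i _ => ?_
      rw [(Submodule.Quotient.mk_eq_zero _).2 (Ideal.mem_span_singleton.2 (h i)), map_zero]
  · intro x
    have h1 : ∀ i, ∃ q : Polynomial K, Submodule.Quotient.mk q = φ (Module.AEval'.of A x) i :=
      fun i => Submodule.Quotient.mk_surjective _ _
    choose p hp using h1
    refine ⟨p, ?_⟩
    apply (Module.AEval'.of A).injective
    apply φ.injective
    rw [hof, key]
    simp only [hp]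
    exact (DirectSum.sum_univ_of _).symm

theorem exists_hasJordanType {K ι : Type*} [Field K] [Fintype ι] (A : Matrix ι ι K) (m : ℕ)
    (hm : A.mulVecLin ^ m = 0) {n : ℕ} (hn : Fintype.card ι = n) :
    ∃ Q : n.Partition, HasJordanType A Q := by
  classical
  obtain ⟨d, c, g, hrel, hgen⟩ := exists_cyclic_decomposition A.mulVecLin m hm
  set Q := Nat.Partition.ofMultiset ((univ : Finset (Fin d)).val.map c) with hQ
  have hmult : ∀ l, l ≠ 0 → mult Q l = (univ.filter fun i => c i = l).card := by
    intro l hl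
    rw [mult, hQ, Nat.Partition.ofMultiset, Nat.Partition.ofSums_parts,
      Multiset.count_filter_of_pos (p := fun x => x ≠ 0) hl, Multiset.count_map,
      Finset.card_def, Finset.filter_val]
    exact congrArg Multiset.card (Multiset.filter_congr fun i _ => eq_comm)
  have hl0 : ∀ l ∈ levels Q, l ≠ 0 := fun l hl => (Q.parts_pos (Multiset.mem_toFinset.1 hl)).ne'
  -- The cyclic summands of dimension `l` are numbered from `1` to `mult Q l`.
  have hnum : ∀ l ∈ levels Q, ∃ f : ℕ → Fin d, Set.BijOn f (Icc 1 (mult Q l))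
      {i | c i = l} := by
    intro l hl
    have hcard : (Icc 1 (mult Q l)).card = (univ.filter fun i => c i = l).card := by
      rw [Nat.card_Icc, hmult l (hl0 l hl), Nat.add_sub_cancel]
    obtain ⟨i₀⟩ : Nonempty (Fin d) := by
      have h1 : 0 < mult Q l := Multiset.count_pos.2 (Multiset.mem_toFinset.1 hl)
      rw [hmult l (hl0 l hl), card_pos] at h1
      exact ⟨h1.choose⟩
    let e := equivOfCardEq hcard
    refine ⟨fun k => if h : k ∈ Icc 1 (mult Q l) then (e ⟨k, h⟩).1 else i₀, ?_⟩
    refine ⟨fun k hk => ?_, fun k hk k' hk' h => ?_, fun i hi => ?_⟩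
    · have := (e ⟨k, mem_coe.1 hk⟩).2
      simp only [mem_filter, mem_univ, true_and] at this
      simp only [dif_pos (mem_coe.1 hk)]
      exact this
    · simp only [dif_pos (mem_coe.1 hk), dif_pos (mem_coe.1 hk')] at h
      exact congrArg Subtype.val (e.injective (Subtype.ext h))
    · have hi' : i ∈ univ.filter fun i => c i = l := mem_filter.2 ⟨mem_univ _, hi⟩
      refine ⟨(e.symm ⟨i, hi'⟩).1, mem_coe.2 (e.symm ⟨i, hi'⟩).2, ?_⟩
      simp only [dif_pos (e.symm ⟨i, hi'⟩).2]
      exact congrArg Subtype.val (e.apply_symm_apply ⟨i, hi'⟩)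
  choose f hf using hnum
  set idx : Vertex Q → Fin d := fun v => f v.1.2.1 v.bounds.1 v.1.2.2 with hidx
  have hc : ∀ v : Vertex Q, c (idx v) = v.1.2.1 := fun v =>
    (hf _ v.bounds.1).1 (by simpa using v.bounds.2.2)
  have hinj : ∀ v w : Vertex Q, idx v = idx w → v.1.1 = w.1.1 → v = w := by
    intro v w h1 h2
    have h3 : v.1.2.1 = w.1.2.1 := by rw [← hc, ← hc, h1]
    have h4 := v.bounds
    have h5 := w.bounds
    obtain ⟨⟨u, l, k⟩, hv⟩ := v
    obtain ⟨⟨u', l', k'⟩, hw⟩ := w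
    simp only at h2 h3 h4 h5
    subst h2 h3
    have h6 := (hf l h4.1).2.1 (by simpa using h4.2.2) (by simpa using h5.2.2) h1
    exact Subtype.ext (Prod.ext rfl (Prod.ext rfl h6))
  have hsurj : ∀ i j, j < c i → ∃ v : Vertex Q, idx v = i ∧ v.1.1 = j + 1 := by
    intro i j hj
    have hlev : c i ∈ levels Q := by
      rw [levels, Multiset.mem_toFinset, ← Multiset.count_pos]
      change 0 < mult Q (c i)
      rw [hmult _ (by omega), card_pos]
      exact ⟨i, by simp⟩
    obtain ⟨k, hk, hki⟩ := (hf _ hlev).2.2 (rfl : c i = c i)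
    refine ⟨⟨(j + 1, c i, k), (mem_vertices_iff _ _).2 ⟨hlev, ⟨by simp, hj⟩, by simpa using hk⟩⟩,
      hki, rfl⟩
  let Φ : (Vertex Q → K) →ₗ[K] (ι → K) :=
    Fintype.linearCombination K fun v => (A.mulVecLin ^ (v.1.1 - 1)) (g (idx v))
  have hΦ : ∀ x, Φ x = ∑ i, Polynomial.aeval A.mulVecLin
      (∑ v : Vertex Q, if idx v = i then Polynomial.monomial (v.1.1 - 1) (x v) else 0) (g i) := by
    intro x
    simp only [Φ, Fintype.linearCombination_apply, map_sum, LinearMap.sum_apply]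
    rw [sum_comm]
    refine sum_congr rfl fun v _ => ?_
    rw [sum_eq_single (idx v)]
    · rw [if_pos rfl, Polynomial.aeval_monomial, ← Algebra.smul_def, LinearMap.smul_apply]
    · intro i _ hi
      rw [if_neg hi.symm, map_zero, LinearMap.zero_apply]
    · simp
  have hkill : ∀ i j, c i ≤ j → (A.mulVecLin ^ j) (g i) = 0 := by
    intro i j hij
    have h1 := (hrel (Pi.single i (Polynomial.X ^ j))).2 fun i' => by
      by_cases h : i' = i
      · subst h
        rw [Pi.single_eq_same]
        exact pow_dvd_pow _ hij
      · rw [Pi.single_eq_of_ne h]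
        exact dvd_zero _
    rw [sum_eq_single i] at h1
    · simpa using h1
    · intro i' _ h
      rw [Pi.single_eq_of_ne h, map_zero, LinearMap.zero_apply]
    · simp
  have hΦ1 : ∀ v : Vertex Q, Φ (Pi.single v 1) = (A.mulVecLin ^ (v.1.1 - 1)) (g (idx v)) := by
    intro v
    rw [Fintype.linearCombination_apply_single, one_smul]
  have hbij : Function.Bijective Φ := by
    constructor
    · rw [injective_iff_map_eq_zero]
      intro x hx
      rw [hΦ, hrel] at hx
      funext v
      have h1 := Polynomial.X_pow_dvd_iff.1 (hx (idx v)) (v.1.1 - 1) (by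
        have := v.bounds.2.1
        rw [hc]
        omega)
      rw [Polynomial.finsetSum_coeff, sum_eq_single v (h₁ := fun h => absurd (mem_univ v) h)] at h1
      · simpa using h1
      · intro w _ hw
        by_cases h : idx w = idx v
        · rw [if_pos h, Polynomial.coeff_monomial, if_neg]
          intro h'
          have h2 := w.bounds.2.1
          have h3 := v.bounds.2.1
          exact hw (hinj w v h (by omega))
        · rw [if_neg h, Polynomial.coeff_zero]
    · rw [← LinearMap.range_eq_top, eq_top_iff]
      intro y _
      obtain ⟨p, rfl⟩ := hgen y
      refine Submodule.sum_mem _ fun i _ => ?_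
      rw [Polynomial.aeval_eq_sum_range, LinearMap.sum_apply]
      refine Submodule.sum_mem _ fun j _ => ?_
      rw [LinearMap.smul_apply]
      refine Submodule.smul_mem _ _ ?_
      by_cases hj : j < c i
      · obtain ⟨v, rfl, hv⟩ := hsurj i j hj
        exact ⟨Pi.single v 1, by rw [hΦ1, hv, Nat.add_sub_cancel]⟩
      · rw [hkill i j (not_lt.1 hj)]
        exact Submodule.zero_mem _
  let e := LinearEquiv.ofBijective Φ hbij
  have hcard : (Multiset.map c univ.val).sum = n := by
    have := e.finrank_eq
    rw [Module.finrank_fintype_fun_eq_card, Module.finrank_fintype_fun_eq_card, hn,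
      Fintype.card_coe, card_vertices] at this
    exact this
  have hcomm : ∀ x, A.mulVec (e x) = e ((jordanMatrix Q K).mulVec x) := by
    suffices h : A.mulVecLin ∘ₗ Φ = Φ ∘ₗ (jordanMatrix Q K).mulVecLin from
      fun x => LinearMap.congr_fun h x
    refine LinearMap.pi_ext' fun v => LinearMap.ext_ring ?_
    simp only [LinearMap.comp_apply, LinearMap.coe_single, Matrix.mulVecLin_apply]
    rw [hΦ1, ← Matrix.mulVecLin_apply, ← Module.End.mul_apply, ← pow_succ',
      Nat.sub_add_cancel v.bounds.2.1.1]
    by_cases hv : v.1.1 < v.1.2.1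
    · have hw : (v.1.1 + 1, v.1.2.1, v.1.2.2) ∈ vertices Q :=
        (mem_vertices_iff _ _).2 ⟨v.bounds.1, ⟨by simp, hv⟩, v.bounds.2.2⟩
      have h1 : (jordanMatrix Q K).mulVec (Pi.single v 1) = Pi.single ⟨_, hw⟩ 1 := by
        funext w
        simp only [Matrix.mulVec_single_one, Matrix.col_apply, jordanMatrix, edgeMatrix,
          Matrix.of_apply, Pi.single_apply, Subtype.ext_iff]
        congr
      rw [h1, hΦ1]
      rfl
    · have h1 : (jordanMatrix Q K).mulVec (Pi.single v 1) = 0 := by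
        funext w
        simp only [Matrix.mulVec_single_one, Matrix.col_apply, jordanMatrix, edgeMatrix,
          Matrix.of_apply, Pi.zero_apply, ite_eq_right_iff, one_ne_zero, imp_false]
        intro hw
        have h2 := w.bounds.2.1.2
        rw [hw] at h2
        simp only at h2
        omega
      rw [h1, map_zero, hkill]
      rw [hc]
      omega
  have hJ : HasJordanType A Q := by
    refine ⟨e.symm, fun x => ?_⟩
    rw [LinearEquiv.symm_apply_eq, ← hcomm, LinearEquiv.apply_symm_apply]
  clear_value Q
  subst hcard
  exact ⟨Q, hJ⟩

/-! ### Expanding a determinant along labelled permutations -/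

theorem prod_monomial_monomial {ι V k : Type*} [CommSemiring k] (t : Finset ι) (a : ι → ℕ)
    (b : ι → V →₀ ℕ) :
    ∏ v ∈ t, Polynomial.monomial (a v) (MvPolynomial.monomial (b v) (1 : k)) =
      Polynomial.monomial (∑ v ∈ t, a v) (MvPolynomial.monomial (∑ v ∈ t, b v) (1 : k)) := by
  classical
  induction t using Finset.induction_on with
  | empty => simp
  | insert x t hx ih =>
    rw [prod_insert hx, sum_insert hx, sum_insert hx, ih, Polynomial.monomial_mul_monomial,
      MvPolynomial.monomial_mul, one_mul]

open Classical in
/-- Let every entry of a matrix be a sum of monomials, one for each label `θ` of an edge `v → v'`.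
The determinant is then a signed sum over the pairs `(σ, f)` of a permutation and a labelling of its
edges, and a monomial that comes from exactly one such pair has coefficient `±1`. -/
theorem coeff_coeff_det_ne_zero {ι Θ V k : Type*} [Fintype ι] [DecidableEq ι] [Fintype Θ] [Field k]
    (E : Θ → ι → ι → Prop) (a : Θ → ℕ) (b : Θ → V →₀ ℕ) (σ₀ : Equiv.Perm ι) (f₀ : ι → Θ)
    (h₀ : ∀ v, E (f₀ v) v (σ₀ v))
    (huniq : ∀ (σ : Equiv.Perm ι) (f : ι → Θ), (∀ v, E (f v) v (σ v)) →
      ∑ v, a (f v) = ∑ v, a (f₀ v) → ∑ v, b (f v) = ∑ v, b (f₀ v) → σ = σ₀ ∧ f = f₀) :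
    ((Matrix.of fun v' v : ι => ∑ θ, if E θ v v' then
      Polynomial.monomial (a θ) (MvPolynomial.monomial (b θ) (1 : k)) else 0).det.coeff
        (∑ v, a (f₀ v))).coeff (∑ v, b (f₀ v)) ≠ 0 := by
  rw [Matrix.det_apply]
  simp only [Matrix.of_apply, prod_univ_sum, Fintype.piFinset_univ, prod_ite_zero, mem_univ,
    forall_const, prod_monomial_monomial, smul_sum, Polynomial.finsetSum_coeff,
    MvPolynomial.coeff_sum]
  rw [sum_eq_single σ₀, sum_eq_single f₀]
  · rw [if_pos h₀]
    rcases Int.units_eq_one_or (Equiv.Perm.sign σ₀) with h | h <;> simp [h]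
  · intro f _ hf
    by_cases hE : ∀ v, E (f v) v (σ₀ v)
    · rw [if_pos hE]
      by_cases h1 : ∑ v, a (f v) = ∑ v, a (f₀ v)
      · by_cases h2 : ∑ v, b (f v) = ∑ v, b (f₀ v)
        · exact absurd (huniq _ _ hE h1 h2).2 hf
        · rcases Int.units_eq_one_or (Equiv.Perm.sign σ₀) with h | h <;>
            simp [h, h1, MvPolynomial.coeff_monomial, h2]
      · rcases Int.units_eq_one_or (Equiv.Perm.sign σ₀) with h | h <;>
          simp [h, Polynomial.coeff_monomial, h1]
    · simp [hE]
  · simp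
  · intro σ _ hσ
    refine sum_eq_zero fun f _ => ?_
    by_cases hE : ∀ v, E (f v) v (σ v)
    · rw [if_pos hE]
      by_cases h1 : ∑ v, a (f v) = ∑ v, a (f₀ v)
      · by_cases h2 : ∑ v, b (f v) = ∑ v, b (f₀ v)
        · exact absurd (huniq _ _ hE h1 h2).1 hσ
        · rcases Int.units_eq_one_or (Equiv.Perm.sign σ) with h | h <;>
            simp [h, h1, MvPolynomial.coeff_monomial, h2]
      · rcases Int.units_eq_one_or (Equiv.Perm.sign σ) with h | h <;>
          simp [h, Polynomial.coeff_monomial, h1]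
    · simp [hE]
  · simp

/-! ### The edges of the simply adequate matrix -/

/-- The largest part `p_1` of `P`. -/
def topLevel {n : ℕ} (P : n.Partition) : ℕ := (levels P).sup id

/-- The variables as a sum type. -/
def varEquiv {n : ℕ} (P : n.Partition) : Var P ≃
    (upperLevels P ⊕ upperLevels P) ⊕ ((Σ j : levels P, Icc 1 (mult P j)) ⊕ oddMinima P) where
  toFun
    | .s i => .inl (.inl i)
    | .t i => .inl (.inr i)
    | .tt j k => .inr (.inl ⟨j, k⟩)
    | .z l => .inr (.inr l)
  invFun
    | .inl (.inl i) => .s i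
    | .inl (.inr i) => .t i
    | .inr (.inl ⟨j, k⟩) => .tt j k
    | .inr (.inr l) => .z l
  left_inv x := by cases x <;> rfl
  right_inv x := by rcases x with (_ | _) | (⟨_, _⟩ | _) <;> rfl

noncomputable instance {n : ℕ} (P : n.Partition) : Fintype (Var P) :=
  Fintype.ofEquiv _ (varEquiv P).symm

theorem sum_var {n : ℕ} (P : n.Partition) {M : Type*} [AddCommMonoid M] (g : Var P → M) :
    ∑ τ, g τ = ∑ i, (g (.s i) + g (.t i)) + ∑ j, ∑ k, g (.tt j k) + ∑ l, g (.z l) := by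
  rw [← (varEquiv P).symm.sum_comp, Fintype.sum_sum_type, Fintype.sum_sum_type,
    Fintype.sum_sum_type, Fintype.sum_sigma, sum_add_distrib, ← add_assoc]
  rfl

/-- The labels of a step from a vertex to a vertex: staying at the vertex, returning from the end of
a path to the start of a path, or an edge of the simply adequate matrix. -/
inductive Step {n : ℕ} (P : n.Partition) : Type
  | stay : Step P
  | ret : Step P
  | edge (τ : Var P) : Step P

/-- The labels as an iterated option type. -/
def stepEquiv {n : ℕ} (P : n.Partition) : Step P ≃ Option (Option (Var P)) where
  toFun
    | .stay => none
    | .ret => some none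
    | .edge τ => some (some τ)
  invFun
    | none => .stay
    | some none => .ret
    | some (some τ) => .edge τ
  left_inv x := by cases x <;> rfl
  right_inv x := by rcases x with _ | _ | _ <;> rfl

noncomputable instance {n : ℕ} (P : n.Partition) : Fintype (Step P) :=
  Fintype.ofEquiv _ (stepEquiv P).symm

theorem sum_step {n : ℕ} (P : n.Partition) {M : Type*} [AddCommMonoid M] (g : Step P → M) :
    ∑ θ, g θ = g .stay + (g .ret + ∑ τ, g (.edge τ)) := by
  rw [← (stepEquiv P).symm.sum_comp, Fintype.sum_option, Fintype.sum_option]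
  rfl

/-- `IsStep P s θ v v'` holds when a step with label `θ` leads from `v` to `v'`. The return steps
lead from the last vertices `(u, p, n_p)` of the `s` upper rows of the top level `p` to the first
vertices `(p + 1 - u, p, 1)` of the `s` lower rows. -/
def IsStep {n : ℕ} (P : n.Partition) (s : ℕ) : Step P → ℕ × ℕ × ℕ → ℕ × ℕ × ℕ → Prop
  | .stay, v, v' => v' = v
  | .ret, v, v' => ∃ u, u ≤ topLevel P ∧ topLevel P + 1 ≤ u + s ∧
      v = (u, topLevel P, mult P (topLevel P)) ∧ v' = (topLevel P + 1 - u, topLevel P, 1)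
  | .edge (.s i), v, v' => ∃ u, 1 ≤ u ∧ u ≤ pred P i ∧
      v = (u, (i : ℕ), mult P i) ∧ v' = (u, pred P i, 1)
  | .edge (.t i), v, v' => ∃ u, 1 ≤ u ∧ u ≤ pred P i ∧
      v = (u, pred P i, mult P (pred P i)) ∧ v' = (u + (i - pred P i), (i : ℕ), 1)
  | .edge (.tt j k), v, v' => (k : ℕ) < mult P j ∧
      ∃ u, 1 ≤ u ∧ u ≤ (j : ℕ) ∧ v = (u, (j : ℕ), (k : ℕ)) ∧ v' = (u, (j : ℕ), (k : ℕ) + 1)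
  | .edge (.z l), v, v' => ∃ u, 1 ≤ u ∧ u < (l : ℕ) ∧
      v = (u, (l : ℕ), mult P l) ∧ v' = (u + 1, (l : ℕ), 1)

/-- The matrix of the return steps. -/
noncomputable def returnMatrix {n : ℕ} (P : n.Partition) (s : ℕ) (K : Type*) [Semiring K] :
    Matrix (Vertex P) (Vertex P) K :=
  edgeMatrix P K (IsStep P s .ret)

open Classical in
theorem simplyAdequate_apply {n : ℕ} (P : n.Partition) (s : ℕ) (k : Type*) [Field k]
    (v' v : Vertex P) : simplyAdequate P k v' v =
      ∑ τ : Var P, if IsStep P s (.edge τ) v.1 v'.1 then MvPolynomial.X τ else 0 := by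
  rw [sum_var]
  simp only [simplyAdequate, Matrix.add_apply, Matrix.sum_apply, Matrix.smul_apply, smul_eq_mul]
  congr 1
  · congr 1
    · refine sum_congr rfl fun i _ => ?_
      simp only [betaMap, alphaMap, edgeMatrix, IsStep, Matrix.of_apply, mul_ite, mul_one, mul_zero]
      congr
    · refine sum_congr rfl fun j _ => sum_congr rfl fun m _ => ?_
      by_cases hm : (m : ℕ) < mult P j
      · simp [eMap, edgeMatrix, IsStep, hm]
      · simp [IsStep, hm]
  · refine sum_congr rfl fun l _ => ?_
    simp only [wMap, edgeMatrix, IsStep, Matrix.of_apply, mul_ite, mul_one, mul_zero]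
    congr

/-- The exponent of `X` in the matrix entry of a label: `X` is the entry of a vertex that stays. -/
def stayWeight {n : ℕ} {P : n.Partition} : Step P → ℕ
  | .stay => 1
  | _ => 0

/-- The exponents of the variables of `R` in the matrix entry of a label. -/
noncomputable def edgeWeight {n : ℕ} {P : n.Partition} : Step P → Var P →₀ ℕ
  | .edge τ => Finsupp.single τ 1
  | _ => 0

open Classical in
theorem charmatrix_eq {n : ℕ} (P : n.Partition) (s : ℕ) (k : Type*) [Field k] :
    (-(simplyAdequate P k + returnMatrix P s (PolyRing P k))).charmatrix =
      Matrix.of fun v' v : Vertex P => ∑ θ, if IsStep P s θ v.1 v'.1 then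
        Polynomial.monomial (stayWeight θ) (MvPolynomial.monomial (edgeWeight θ) (1 : k))
      else 0 := by
  funext v' v
  rw [Matrix.charmatrix_apply, Matrix.of_apply, sum_step, Matrix.neg_apply, Matrix.add_apply,
    simplyAdequate_apply P s, map_neg, sub_neg_eq_add, map_add]
  congr 1
  · rw [Matrix.diagonal_apply]
    by_cases h : IsStep P s .stay v.1 v'.1
    · rw [if_pos (Subtype.ext h), if_pos h]
      rfl
    · rw [if_neg fun h' => h (congrArg Subtype.val h'), if_neg h]
  · rw [add_comm]
    congr 1
    · simp only [returnMatrix, edgeMatrix, Matrix.of_apply, stayWeight, edgeWeight]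
      split_ifs <;> simp
    · rw [map_sum]
      refine sum_congr rfl fun τ _ => ?_
      simp only [stayWeight, edgeWeight]
      split_ifs
      · rw [Polynomial.monomial_zero_left]
        rfl
      · simp

/-! ### Levels -/

section Levels

variable {n : ℕ} (P : n.Partition)

theorem pos_of_mem_levels {l : ℕ} (hl : l ∈ levels P) : 0 < l :=
  P.parts_pos (Multiset.mem_toFinset.1 hl)

theorem mult_pos {l : ℕ} (hl : l ∈ levels P) : 0 < mult P l :=
  Multiset.count_pos.2 (Multiset.mem_toFinset.1 hl)

theorem upperLevels_subset {i : ℕ} (hi : i ∈ upperLevels P) : i ∈ levels P :=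
  (mem_filter.1 hi).1

theorem le_pred {i j : ℕ} (hj : j ∈ levels P) (h : j < i) : j ≤ pred P i :=
  le_sup (f := id) (mem_filter.2 ⟨hj, h⟩)

theorem pred_mem_filter {i : ℕ} (hi : i ∈ upperLevels P) :
    pred P i ∈ (levels P).filter fun j => j < i := by
  obtain ⟨j, hj, hji⟩ := (mem_filter.1 hi).2
  obtain ⟨x, hx, hx'⟩ := exists_mem_eq_sup ((levels P).filter fun j => j < i)
    ⟨j, mem_filter.2 ⟨hj, hji⟩⟩ id
  rw [pred, hx']
  exact hx

theorem pred_mem {i : ℕ} (hi : i ∈ upperLevels P) : pred P i ∈ levels P :=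
  (mem_filter.1 (pred_mem_filter P hi)).1

theorem pred_lt {i : ℕ} (hi : i ∈ upperLevels P) : pred P i < i :=
  (mem_filter.1 (pred_mem_filter P hi)).2

theorem pred_injOn {i j : ℕ} (hi : i ∈ upperLevels P) (hj : j ∈ upperLevels P)
    (h : pred P i = pred P j) : i = j := by
  have h1 := pred_lt P hi
  have h2 := pred_lt P hj
  rcases lt_trichotomy i j with h3 | h3 | h3
  · have := le_pred P (upperLevels_subset P hi) h3
    omega
  · exact h3
  · have := le_pred P (upperLevels_subset P hj) h3
    omega

theorem le_topLevel {l : ℕ} (hl : l ∈ levels P) : l ≤ topLevel P :=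
  le_sup (f := id) hl

theorem topLevel_mem {l : ℕ} (hl : l ∈ levels P) : topLevel P ∈ levels P := by
  obtain ⟨x, hx, hx'⟩ := exists_mem_eq_sup (levels P) ⟨l, hl⟩ id
  rw [topLevel, hx']
  exact hx

theorem exists_pred_eq {l : ℕ} (hl : l ∈ levels P) (h : l ≠ topLevel P) :
    ∃ i ∈ upperLevels P, pred P i = l := by
  have hne : ((levels P).filter fun j => l < j).Nonempty :=
    ⟨topLevel P, mem_filter.2 ⟨topLevel_mem P hl, lt_of_le_of_ne (le_topLevel P hl) h⟩⟩
  obtain ⟨hi, hli⟩ := mem_filter.1 (min'_mem _ hne)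
  have hup : min' _ hne ∈ upperLevels P := mem_filter.2 ⟨hi, l, hl, hli⟩
  refine ⟨_, hup, le_antisymm ?_ (le_pred P hl hli)⟩
  by_contra hlt
  have h1 : min' _ hne ≤ pred P (min' _ hne) :=
    min'_le _ _ (mem_filter.2 ⟨pred_mem P hup, not_le.1 hlt⟩)
  have h2 := pred_lt P hup
  omega

end Levels

/-! ### Path systems -/

/-- The shape of a system of `s` vertex-disjoint paths running from the `s` lowest rows of the top
level to its `s` highest rows. At level `l` the rows `u ≤ down l` are left along `β_l`, the rows
`u > l - up l` are left towards the next higher level (or are ends of paths, at the top level), and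
the remaining rows are left along `w_l` if the level is `full`, and are not visited otherwise. -/
structure PathSystem {n : ℕ} (P : n.Partition) (s : ℕ) where
  /-- The number of rows of a level left along `β_l`. -/
  down : ℕ → ℕ
  /-- The number of rows of a level left towards the next higher level. -/
  up : ℕ → ℕ
  /-- The levels required to have all their rows visited. -/
  full : ℕ → Prop
  up_pred : ∀ i ∈ upperLevels P, up (pred P i) = down i
  up_top : up (topLevel P) = s
  down_eq_zero : ∀ l ∈ levels P, l ∉ upperLevels P → down l = 0
  add_le : ∀ l ∈ levels P, down l + up l ≤ l
  of_not_full : ∀ l ∈ levels P, ¬ full l → down l = up l ∨ down l + up l = l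
  of_full : ∀ l ∈ levels P, full l → down l + up l = l ∨ up l = down l + 1 ∧ l ∈ oddMinima P

namespace PathSystem

variable {n : ℕ} {P : n.Partition} {s : ℕ} (C : PathSystem P s)

/-- The vertices visited by the paths. -/
def Visits (v : ℕ × ℕ × ℕ) : Prop :=
  v.1 ≤ C.down v.2.1 ∨ v.2.1 < v.1 + C.up v.2.1 ∨ C.full v.2.1

/-- `C.IsLabel θ v` holds when the path system leaves the vertex `v` along a step labelled `θ`. -/
def IsLabel : Step P → ℕ × ℕ × ℕ → Prop
  | .stay, v => ¬ C.Visits v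
  | .ret, v => v.2.1 = topLevel P ∧ v.2.2 = mult P v.2.1 ∧ v.2.1 < v.1 + C.up v.2.1
  | .edge (.s i), v => v.2.1 = i ∧ v.2.2 = mult P v.2.1 ∧ v.1 ≤ C.down v.2.1
  | .edge (.t i), v => v.2.1 = pred P i ∧ v.2.2 = mult P v.2.1 ∧ v.2.1 < v.1 + C.up v.2.1
  | .edge (.tt j k), v => C.Visits v ∧ v.2.1 = j ∧ v.2.2 = k ∧ v.2.2 < mult P v.2.1
  | .edge (.z l), v => C.full v.2.1 ∧ v.2.1 = l ∧ v.2.2 = mult P v.2.1 ∧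
      C.down v.2.1 < v.1 ∧ v.1 + C.up v.2.1 ≤ v.2.1

theorem exists_isLabel {v : ℕ × ℕ × ℕ} (hv : v ∈ vertices P) :
    ∃ θ v', v' ∈ vertices P ∧ C.IsLabel θ v ∧ IsStep P s θ v v' := by
  have hv' := (mem_vertices_iff P v).1 hv
  obtain ⟨u, l, m⟩ := v
  obtain ⟨hl, ⟨hu1, hul⟩, hm1, hm⟩ := hv'
  simp only at hl hu1 hul hm1 hm
  have hadd := C.add_le l hl
  by_cases hvis : C.Visits (u, l, m)
  swap
  · exact ⟨.stay, _, hv, hvis, rfl⟩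
  rcases hm.lt_or_eq with hm | hm
  · refine ⟨.edge (.tt ⟨l, hl⟩ ⟨m, mem_Icc.2 ⟨hm1, hm.le⟩⟩), (u, l, m + 1), ?_,
      ⟨hvis, rfl, rfl, hm⟩, hm, u, hu1, hul, rfl, rfl⟩
    rw [mem_vertices]
    exact ⟨hl, ⟨hu1, hul⟩, by omega, hm⟩
  by_cases hd : u ≤ C.down l
  · have hup : l ∈ upperLevels P := by
      by_contra h
      have := C.down_eq_zero l hl h
      omega
    have hp := C.add_le _ (pred_mem P hup)
    rw [C.up_pred l hup] at hp
    refine ⟨.edge (.s ⟨l, hup⟩), (u, pred P l, 1), ?_, ⟨rfl, hm, hd⟩,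
      u, hu1, by simp only; omega, by rw [hm], rfl⟩
    rw [mem_vertices]
    exact ⟨pred_mem P hup, ⟨hu1, by omega⟩, le_rfl, mult_pos P (pred_mem P hup)⟩
  by_cases hupr : l < u + C.up l
  · by_cases htop : l = topLevel P
    · refine ⟨.ret, (topLevel P + 1 - u, topLevel P, 1), ?_, ⟨htop, hm, hupr⟩,
        u, by omega, ?_, by rw [hm, ← htop], rfl⟩
      · rw [mem_vertices, ← htop]
        exact ⟨hl, by omega, le_rfl, mult_pos P hl⟩
      · rw [← C.up_top, ← htop]
        omega
    · obtain ⟨i, hi, rfl⟩ := exists_pred_eq P hl htop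
      have := pred_lt P hi
      refine ⟨.edge (.t ⟨i, hi⟩), (u + (i - pred P i), i, 1), ?_, ⟨rfl, hm, hupr⟩,
        u, hu1, hul, by rw [hm], rfl⟩
      rw [mem_vertices]
      exact ⟨upperLevels_subset P hi, by omega, le_rfl, mult_pos P (upperLevels_subset P hi)⟩
  · have hfull : C.full l := by
      rcases hvis with h | h | h
      · exact absurd h hd
      · exact absurd h hupr
      · exact h
    have hodd : l ∈ oddMinima P := by
      rcases C.of_full l hl hfull with h | h
      · omega
      · exact h.2
    refine ⟨.edge (.z ⟨l, hodd⟩), (u + 1, l, 1), ?_, ⟨hfull, rfl, hm, by simpa using hd,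
      by simpa using hupr⟩, u, hu1, ?_, by rw [hm], rfl⟩
    · rw [mem_vertices]
      refine ⟨hl, ?_, le_rfl, mult_pos P hl⟩
      rcases C.of_full l hl hfull with h | h <;> omega
    · simp only
      rcases C.of_full l hl hfull with h | h <;> omega

theorem isLabel_unique {v : ℕ × ℕ × ℕ} (hv : v ∈ vertices P) {θ θ' : Step P}
    (h : C.IsLabel θ v) (h' : C.IsLabel θ' v) : θ = θ' := by
  have hv' := (mem_vertices_iff P v).1 hv
  have hadd := C.add_le _ hv'.1
  have hpt : ∀ i : upperLevels P, pred P i < topLevel P := fun i =>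
    (pred_lt P i.2).trans_le (le_topLevel P (upperLevels_subset P i.2))
  have hpi : ∀ i j : upperLevels P, pred P i = pred P j → i = j := fun i j h =>
    Subtype.ext (pred_injOn P i.2 j.2 h)
  rcases θ with _ | _ | (i | i | ⟨j, k⟩ | l) <;>
  rcases θ' with _ | _ | (i' | i' | ⟨j', k'⟩ | l') <;>
  simp only [IsLabel, Visits] at h h' <;>
  first
  | rfl
  | (exfalso; tauto)
  | (exfalso; omega)
  | (exfalso; have := hpt i; omega)
  | (exfalso; have := hpt i'; omega)
  | skip
  · obtain rfl : i = i' := Subtype.ext (by omega)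
    rfl
  · obtain rfl : i = i' := hpi _ _ (by omega)
    rfl
  · obtain rfl : j = j' := Subtype.ext (by omega)
    obtain rfl : k = k' := Subtype.ext (by omega)
    rfl
  · obtain rfl : l = l' := Subtype.ext (by omega)
    rfl

end PathSystem

theorem isStep_unique {n : ℕ} {P : n.Partition} {s : ℕ} {θ : Step P} {v v' v'' : ℕ × ℕ × ℕ}
    (h' : IsStep P s θ v v') (h'' : IsStep P s θ v v'') : v' = v'' := by
  rcases θ with _ | _ | (i | i | ⟨j, k⟩ | l)
  · exact h'.trans h''.symm
  · obtain ⟨u, -, -, rfl, rfl⟩ := h'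
    obtain ⟨u', -, -, h, rfl⟩ := h''
    rw [(Prod.mk.inj h).1]
  · obtain ⟨u, -, -, rfl, rfl⟩ := h'
    obtain ⟨u', -, -, h, rfl⟩ := h''
    rw [(Prod.mk.inj h).1]
  · obtain ⟨u, -, -, rfl, rfl⟩ := h'
    obtain ⟨u', -, -, h, rfl⟩ := h''
    rw [(Prod.mk.inj h).1]
  · obtain ⟨-, u, -, -, rfl, rfl⟩ := h'
    obtain ⟨-, u', -, -, h, rfl⟩ := h''
    rw [(Prod.mk.inj h).1]
  · obtain ⟨u, -, -, rfl, rfl⟩ := h'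
    obtain ⟨u', -, -, h, rfl⟩ := h''
    rw [(Prod.mk.inj h).1]

namespace PathSystem

variable {n : ℕ} {P : n.Partition} {s : ℕ} (C : PathSystem P s)

theorem visits_of_le_up {u l m : ℕ} (hl : l ∈ levels P) (h : u ≤ C.up l) : C.Visits (u, l, m) := by
  by_cases hf : C.full l
  · exact Or.inr (Or.inr hf)
  · simp only [Visits]
    rcases C.of_not_full l hl hf with h' | h' <;> omega

theorem visits_of_lt_add_down {u l m : ℕ} (hl : l ∈ levels P) (h : l < u + C.down l) :
    C.Visits (u, l, m) := by
  by_cases hf : C.full l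
  · exact Or.inr (Or.inr hf)
  · simp only [Visits]
    rcases C.of_not_full l hl hf with h' | h' <;> omega

/-- `C.IsEntry θ v'` describes the vertices `v'` entered along a step labelled `θ`. -/
def IsEntry : Step P → ℕ × ℕ × ℕ → Prop
  | .stay, v => ¬ C.Visits v
  | .ret, v => C.Visits v ∧ v.2.1 = topLevel P ∧ v.2.2 = 1 ∧ v.1 ≤ C.up v.2.1
  | .edge (.s i), v => C.Visits v ∧ v.2.1 = pred P i ∧ v.2.2 = 1 ∧ v.1 ≤ C.up v.2.1
  | .edge (.t i), v => C.Visits v ∧ v.2.1 = i ∧ v.2.2 = 1 ∧ v.2.1 < v.1 + C.down v.2.1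
  | .edge (.tt j k), v => C.Visits v ∧ v.2.1 = j ∧ v.2.2 = k + 1 ∧ 2 ≤ v.2.2
  | .edge (.z l), v => C.Visits v ∧ v.2.1 = l ∧ v.2.2 = 1 ∧
      C.down v.2.1 + 2 ≤ v.1 ∧ v.1 + C.up v.2.1 ≤ v.2.1 + 1 ∧ C.up v.2.1 = C.down v.2.1 + 1

theorem isEntry {v v' : ℕ × ℕ × ℕ} (hv : v ∈ vertices P) {θ : Step P} (h : C.IsLabel θ v)
    (h' : IsStep P s θ v v') : C.IsEntry θ v' := by
  have hb := (mem_vertices_iff P v).1 hv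
  rcases θ with _ | _ | (i | i | ⟨j, k⟩ | l)
  · obtain rfl : v' = v := h'
    exact h
  · obtain ⟨u, hu, hus, rfl, rfl⟩ := h'
    have hup : topLevel P + 1 - u ≤ C.up (topLevel P) := by rw [C.up_top]; omega
    exact ⟨C.visits_of_le_up hb.1 hup, rfl, rfl, hup⟩
  · obtain ⟨u, hu1, hu, rfl, rfl⟩ := h'
    have hup : u ≤ C.up (pred P i) := by rw [C.up_pred i i.2]; exact h.2.2
    exact ⟨C.visits_of_le_up (pred_mem P i.2) hup, rfl, rfl, hup⟩
  · obtain ⟨u, hu1, hu, rfl, rfl⟩ := h'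
    have hdown : (i : ℕ) < u + (i - pred P i) + C.down i := by
      have h1 := h.2.2
      simp only [C.up_pred i i.2] at h1
      have := pred_lt P i.2
      omega
    exact ⟨C.visits_of_lt_add_down (upperLevels_subset P i.2) hdown, rfl, rfl, hdown⟩
  · obtain ⟨hk, u, hu1, hu, rfl, rfl⟩ := h'
    have := (mem_Icc.1 k.2).1
    exact ⟨h.1, rfl, rfl, by simp only; omega⟩
  · obtain ⟨u, hu1, hu, rfl, rfl⟩ := h'
    obtain ⟨hf, -, -, h1, h2⟩ := h
    refine ⟨Or.inr (Or.inr hf), rfl, rfl, by simp only at *; omega, by simp only at *; omega, ?_⟩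
    rcases C.of_full _ hb.1 hf with h3 | h3
    · simp only at *
      omega
    · exact h3.1

/-- A vertex is entered along one label only. -/
theorem isEntry_unique {v : ℕ × ℕ × ℕ} (hv : v.2.1 ∈ levels P) {θ θ' : Step P}
    (h : C.IsEntry θ v) (h' : C.IsEntry θ' v) : θ = θ' := by
  have hadd := C.add_le _ hv
  have hpt : ∀ i : upperLevels P, pred P i < topLevel P := fun i =>
    (pred_lt P i.2).trans_le (le_topLevel P (upperLevels_subset P i.2))
  have hpi : ∀ i j : upperLevels P, pred P i = pred P j → i = j := fun i j h =>
    Subtype.ext (pred_injOn P i.2 j.2 h)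
  rcases θ with _ | _ | (i | i | ⟨j, k⟩ | l) <;>
  rcases θ' with _ | _ | (i' | i' | ⟨j', k'⟩ | l') <;>
  simp only [IsEntry] at h h' <;>
  first
  | rfl
  | (exfalso; tauto)
  | (exfalso; omega)
  | (exfalso; have := hpt i; omega)
  | (exfalso; have := hpt i'; omega)
  | skip
  · obtain rfl : i = i' := hpi _ _ (by omega)
    rfl
  · obtain rfl : i = i' := Subtype.ext (by omega)
    rfl
  · obtain rfl : j = j' := Subtype.ext (by omega)
    obtain rfl : k = k' := Subtype.ext (by omega)
    rfl
  · obtain rfl : l = l' := Subtype.ext (by omega)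
    rfl

theorem isStep_injective {θ : Step P} {v w v' : ℕ × ℕ × ℕ}
    (h : IsStep P s θ v v') (h' : IsStep P s θ w v') : v = w := by
  rcases θ with _ | _ | (i | i | ⟨j, k⟩ | l)
  · exact h.symm.trans h'
  · obtain ⟨u, hu, -, rfl, rfl⟩ := h
    obtain ⟨u', hu', -, rfl, h⟩ := h'
    have := (Prod.mk.inj h).1
    obtain rfl : u = u' := by omega
    rfl
  · obtain ⟨u, -, -, rfl, rfl⟩ := h
    obtain ⟨u', -, -, rfl, h⟩ := h'
    rw [(Prod.mk.inj h).1]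
  · obtain ⟨u, -, -, rfl, rfl⟩ := h
    obtain ⟨u', -, -, rfl, h⟩ := h'
    have := (Prod.mk.inj h).1
    obtain rfl : u = u' := by omega
    rfl
  · obtain ⟨-, u, -, -, rfl, rfl⟩ := h
    obtain ⟨-, u', -, -, rfl, h⟩ := h'
    rw [(Prod.mk.inj h).1]
  · obtain ⟨u, -, -, rfl, rfl⟩ := h
    obtain ⟨u', -, -, rfl, h⟩ := h'
    have := (Prod.mk.inj h).1
    obtain rfl : u = u' := by omega
    rfl

/-- The successor map of a path system, closed up by the return steps and extended by the identity
off the paths, is a permutation of the vertices. -/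
theorem exists_perm : ∃ (σ : Equiv.Perm (Vertex P)) (f : Vertex P → Step P),
    (∀ v, C.IsLabel (f v) v.1) ∧ ∀ v, IsStep P s (f v) v.1 (σ v).1 := by
  have h : ∀ v : Vertex P, ∃ (θ : Step P) (v' : Vertex P), C.IsLabel θ v.1 ∧
      IsStep P s θ v.1 v'.1 := fun v => by
    obtain ⟨θ, v', hv', h⟩ := C.exists_isLabel v.2
    exact ⟨θ, ⟨v', hv'⟩, h⟩
  choose f g hf hg using h
  have hinj : Function.Injective g := by
    intro v w hvw
    have h1 := C.isEntry v.2 (hf v) (hg v)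
    have h2 := C.isEntry w.2 (hf w) (hg w)
    rw [← hvw] at h2
    have h3 := C.isEntry_unique (g v).bounds.1 h1 h2
    have h4 := hg w
    rw [← hvw, ← h3] at h4
    exact Subtype.ext (isStep_injective (hg v) h4)
  exact ⟨Equiv.ofBijective g (Finite.injective_iff_bijective.1 hinj), f, hf, hg⟩

end PathSystem

/-! ### Uniqueness of the path system with given edge counts -/

/-- Among the sets of a given cardinality, one whose elements precede all others has the smallest
sum, and is the only one with that sum. -/
theorem sum_le_sum_of_initial {ι : Type*} [DecidableEq ι] {A B : Finset ι} (w : ι → ℤ)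
    (hcard : A.card = B.card) (h : ∀ x ∈ A, x ∉ B → ∀ y ∈ B, w y < w x) :
    ∑ x ∈ B, w x ≤ ∑ x ∈ A, w x ∧ (∑ x ∈ A, w x = ∑ x ∈ B, w x → A = B) := by
  have hAB : (A \ B).card = (B \ A).card := card_sdiff_comm hcard
  have hA := sum_sdiff_sub_sum_sdiff (s₁ := A) (s₂ := B) (f := w)
  rcases (A \ B).eq_empty_or_nonempty with he | hne
  · rw [he, card_empty, eq_comm, card_eq_zero] at hAB
    have : A = B := (sdiff_eq_empty_iff_subset.1 he).antisymm (sdiff_eq_empty_iff_subset.1 hAB)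
    subst this
    exact ⟨le_rfl, fun _ => rfl⟩
  · have hne' : (B \ A).Nonempty := by rwa [← card_pos, ← hAB, card_pos]
    obtain ⟨y, hy, hymax⟩ := exists_max_image _ w hne'
    have h1 := sum_le_card_nsmul (B \ A) w (w y) hymax
    have h2 := card_nsmul_le_sum (A \ B) w (w y + 1) fun x hx => by
      rw [mem_sdiff] at hx hy
      exact h x hx.1 hx.2 y hy.1
    have h3 : 0 < ((A \ B).card : ℤ) := by exact_mod_cast card_pos.2 hne
    rw [nsmul_eq_mul] at h1 h2
    rw [hAB] at h2 h3
    constructor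
    · nlinarith
    · intro h4
      nlinarith

open Classical in
theorem sum_comp_eq_of_card_eq {ι Θ M : Type*} [Fintype ι] [Fintype Θ] [AddCommMonoid M]
    {f g : ι → Θ}
    (h : ∀ θ, (univ.filter fun v => f v = θ).card = (univ.filter fun v => g v = θ).card)
    (c : Θ → M) : ∑ v, c (f v) = ∑ v, c (g v) := by
  have key : ∀ f : ι → Θ, ∑ v, c (f v) = ∑ θ, (univ.filter fun v => f v = θ).card • c θ := by
    intro f
    rw [← sum_fiberwise univ f]
    refine sum_congr rfl fun θ _ => ?_
    rw [sum_congr rfl fun v hv => by rw [(mem_filter.1 hv).2], sum_const]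
  rw [key, key]
  simp only [h]

/-- The potential `u` on the levels `≥ i`, and `0` below. -/
def potential (i : ℕ) (v : ℕ × ℕ × ℕ) : ℤ := if i ≤ v.2.1 then v.1 else 0

/-- The part of the increase of `potential i` along a step that depends only on the label. -/
def potentialGain {n : ℕ} {P : n.Partition} (i : ℕ) : Step P → ℤ
  | .stay => 0
  | .ret => topLevel P + 1
  | .edge (.s _) => 0
  | .edge (.t j) => if i ≤ (j : ℕ) then (j : ℤ) - pred P j else 0
  | .edge (.tt _ _) => 0
  | .edge (.z l) => if i ≤ (l : ℕ) then 1 else 0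

open Classical in
/-- Apart from the term `potentialGain`, the increase of `potential i` along a step depends on the
row only for the edges `α_i`, `β_i` and the return steps. -/
theorem potential_sub {n : ℕ} {P : n.Partition} {s : ℕ} (i : upperLevels P) {θ : Step P}
    {v v' : ℕ × ℕ × ℕ} (h : IsStep P s θ v v') : potential i v' - potential i v =
      potentialGain i θ + (if θ = .edge (.t i) then (v.1 : ℤ) else 0) -
        (if θ = .edge (.s i) then (v.1 : ℤ) else 0) - 2 * (if θ = .ret then (v.1 : ℤ) else 0) := by
  have hi := upperLevels_subset P i.2
  have hpi := pred_lt P i.2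
  rcases θ with _ | _ | (j | j | ⟨j, k⟩ | l)
  · obtain rfl : v' = v := h
    simp [potentialGain]
  · obtain ⟨u, hu, -, rfl, rfl⟩ := h
    have := le_topLevel P hi
    simp only [potential, potentialGain, this, if_true, reduceCtorEq, if_false]
    push_cast [Nat.cast_sub (show u ≤ topLevel P + 1 by omega)]
    ring
  · obtain ⟨u, -, -, rfl, rfl⟩ := h
    have hpj := pred_lt P j.2
    simp only [potential, potentialGain, reduceCtorEq, if_false, Step.edge.injEq, Var.s.injEq]
    rcases lt_trichotomy (i : ℕ) j with hij | hij | hij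
    · have := le_pred P hi hij
      have hne : j ≠ i := fun h => by subst h; omega
      simp [this, hij.le, hne]
    · obtain rfl : j = i := Subtype.ext hij.symm
      simp [hpj]
    · have hne : j ≠ i := fun h => by subst h; omega
      have h1 : ¬ (i : ℕ) ≤ j := by omega
      have h2 : ¬ (i : ℕ) ≤ pred P j := by omega
      simp [h1, h2, hne]
  · obtain ⟨u, -, -, rfl, rfl⟩ := h
    have hpj := pred_lt P j.2
    simp only [potential, potentialGain, reduceCtorEq, if_false, Step.edge.injEq, Var.t.injEq]
    have hcast : ((u + (j - pred P j) : ℕ) : ℤ) = u + ((j : ℤ) - pred P j) := by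
      push_cast [Nat.cast_sub hpj.le]
      ring
    rcases lt_trichotomy (i : ℕ) j with hij | hij | hij
    · have := le_pred P hi hij
      have hne : j ≠ i := fun h => by subst h; omega
      rw [if_pos hij.le, if_pos this, if_pos hij.le, if_neg hne, hcast]
      ring
    · obtain rfl : j = i := Subtype.ext hij.symm
      rw [if_pos le_rfl, if_neg (by omega), if_pos le_rfl, if_pos rfl, hcast]
      ring
    · have hne : j ≠ i := fun h => by subst h; omega
      rw [if_neg (by omega), if_neg (by omega), if_neg (by omega), if_neg hne]
      ring
  · obtain ⟨-, u, -, -, rfl, rfl⟩ := h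
    simp [potential, potentialGain]
  · obtain ⟨u, -, -, rfl, rfl⟩ := h
    simp only [potential, potentialGain, reduceCtorEq, if_false, Step.edge.injEq]
    split_ifs <;> simp

open Classical in
theorem sum_potential {n : ℕ} {P : n.Partition} {s : ℕ} (i : upperLevels P)
    {σ : Equiv.Perm (Vertex P)} {f : Vertex P → Step P}
    (h : ∀ v, IsStep P s (f v) v.1 (σ v).1) :
    (0 : ℤ) = ∑ v, potentialGain i (f v) + ∑ v with f v = .edge (.t i), (v.1.1 : ℤ) -
      ∑ v with f v = .edge (.s i), (v.1.1 : ℤ) - 2 * ∑ v with f v = .ret, (v.1.1 : ℤ) := by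
  have h1 : ∑ v : Vertex P, (potential i (σ v).1 - potential i v.1) = 0 := by
    rw [sum_sub_distrib, Equiv.sum_comp σ fun v : Vertex P => potential i v.1, sub_self]
  rw [← h1, sum_congr rfl fun v _ => potential_sub i (h v), sum_sub_distrib, sum_sub_distrib,
    sum_add_distrib, ← mul_sum, sum_filter, sum_filter, sum_filter]

namespace PathSystem

variable {n : ℕ} {P : n.Partition} {s : ℕ} (C : PathSystem P s)

open Classical in
/-- A permutation with labelled steps that uses every label as often as the path system does is the
permutation of the path system. For each upper level `i`, the sum of the potential forces the rows
leaving along `α_i` to be as high, and the rows leaving along `β_i` to be as low, as they can be;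
this is what the path system does. -/
theorem unique {σ₀ σ : Equiv.Perm (Vertex P)} {f₀ f : Vertex P → Step P}
    (hlab : ∀ v, C.IsLabel (f₀ v) v.1) (h₀ : ∀ v, IsStep P s (f₀ v) v.1 (σ₀ v).1)
    (h : ∀ v, IsStep P s (f v) v.1 (σ v).1)
    (hcard : ∀ θ, (univ.filter fun v => f v = θ).card = (univ.filter fun v => f₀ v = θ).card) :
    σ = σ₀ ∧ f = f₀ := by
  have heq : ∀ {v θ}, C.IsLabel θ v.1 → f₀ v = θ := fun {v θ} hθ =>
    C.isLabel_unique v.2 (hlab v) hθ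
  -- The return steps available are exactly the `s` return steps of the path system.
  have hret : (univ.filter fun v => f v = .ret) = univ.filter fun v => f₀ v = .ret := by
    refine eq_of_subset_of_card_le (fun v hv => ?_) (hcard _).ge
    simp only [mem_filter, mem_univ, true_and] at hv ⊢
    have h1 := h v
    rw [hv] at h1
    obtain ⟨u, hu, hus, hvu, -⟩ := h1
    refine heq ⟨by rw [hvu], by rw [hvu], ?_⟩
    rw [hvu]
    simp only [C.up_top]
    omega
  have hst : ∀ i, (univ.filter fun v => f v = .edge (.s i)) =
      (univ.filter fun v => f₀ v = .edge (.s i)) ∧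
      (univ.filter fun v => f v = .edge (.t i)) = univ.filter fun v => f₀ v = .edge (.t i) := by
    intro i
    -- Both sums are extremal for the path system, and their difference is determined.
    have e1 := sum_potential i h
    have e2 := sum_potential i h₀
    rw [hret, sum_comp_eq_of_card_eq hcard] at e1
    have b1 := sum_le_sum_of_initial (fun v : Vertex P => (v.1.1 : ℤ)) (hcard (.edge (.s i)))
      (fun x hx hx' y hy => by
        simp only [mem_filter, mem_univ, true_and] at hx hx' hy
        have h1 := h x
        rw [hx] at h1
        obtain ⟨u, -, -, hxu, -⟩ := h1
        have h2 := hlab y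
        rw [hy] at h2
        have h3 : ¬ x.1.1 ≤ C.down i := fun hle =>
          hx' (heq ⟨by rw [hxu], by rw [hxu], by rw [hxu] at hle ⊢; exact hle⟩)
        have h4 := h2.2.2
        rw [h2.1] at h4
        omega)
    have b2 := sum_le_sum_of_initial (fun v : Vertex P => -(v.1.1 : ℤ)) (hcard (.edge (.t i)))
      (fun x hx hx' y hy => by
        simp only [mem_filter, mem_univ, true_and] at hx hx' hy
        have h1 := h x
        rw [hx] at h1
        obtain ⟨u, -, -, hxu, -⟩ := h1
        have h2 := hlab y
        rw [hy] at h2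
        have h3 : ¬ pred P i < x.1.1 + C.up (pred P i) := fun hlt =>
          hx' (heq ⟨by rw [hxu], by rw [hxu], by rw [hxu] at hlt ⊢; exact hlt⟩)
        have h4 := h2.2.2
        rw [h2.1] at h4
        omega)
    simp only [sum_neg_distrib] at b2
    exact ⟨b1.2 (by linarith [b1.1, b2.1]), b2.2 (by linarith [b1.1, b2.1])⟩
  have hret' : ∀ v, f v = .ret ↔ f₀ v = .ret := fun v => by
    simpa using Finset.ext_iff.1 hret v
  have hs' : ∀ v i, f v = .edge (.s i) ↔ f₀ v = .edge (.s i) := fun v i => by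
    simpa using Finset.ext_iff.1 (hst i).1 v
  have ht' : ∀ v i, f v = .edge (.t i) ↔ f₀ v = .edge (.t i) := fun v i => by
    simpa using Finset.ext_iff.1 (hst i).2 v
  have hz : ∀ l, (univ.filter fun v => f v = .edge (.z l)) =
      univ.filter fun v => f₀ v = .edge (.z l) := by
    intro l
    refine eq_of_subset_of_card_le (fun v hv => ?_) (hcard _).ge
    have hpos : 0 < (univ.filter fun v => f₀ v = .edge (.z l)).card := by
      rw [← hcard]
      exact card_pos.2 ⟨v, hv⟩
    obtain ⟨w, hw⟩ := card_pos.1 hpos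
    simp only [mem_filter, mem_univ, true_and] at hv hw ⊢
    have hwl := hlab w
    rw [hw] at hwl
    -- A level at which the path system uses `w_l` is full, so `v` does not stay.
    have hfull : C.full l := by
      have := hwl.1
      rwa [hwl.2.1] at this
    have h1 := h v
    rw [hv] at h1
    obtain ⟨u, -, -, hvu, -⟩ := h1
    have h2 := hlab v
    rcases hθ : f₀ v with _ | _ | (i | i | ⟨j, k⟩ | l')
    · rw [hθ] at h2
      exact absurd (Or.inr (Or.inr (by rw [hvu]; exact hfull))) h2
    · rw [(hret' v).2 hθ] at hv
      cases hv
    · rw [(hs' v i).2 hθ] at hv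
      cases hv
    · rw [(ht' v i).2 hθ] at hv
      cases hv
    · rw [hθ, hvu] at h2
      exact absurd h2.2.2.2 (lt_irrefl _)
    · rw [hθ, hvu] at h2
      rw [Subtype.ext h2.2.1]
  have hz' : ∀ v l, f v = .edge (.z l) ↔ f₀ v = .edge (.z l) := fun v l => by
    simpa using Finset.ext_iff.1 (hz l) v
  -- The vertices of a row are treated from the last one backwards.
  have hvis : ∀ (d : ℕ) (v : Vertex P), f₀ v ≠ .stay → mult P v.1.2.1 - v.1.2.2 = d →
      f v = f₀ v := by
    intro d
    induction d with
    | zero =>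
      intro v hv hd
      have hb := v.bounds.2.2
      rcases hθ : f₀ v with _ | _ | (i | i | ⟨j, k⟩ | l)
      · exact absurd hθ hv
      · exact (hret' v).2 hθ
      · exact (hs' v i).2 hθ
      · exact (ht' v i).2 hθ
      · have h2 := hlab v
        rw [hθ] at h2
        have := h2.2.2.2
        omega
      · exact (hz' v l).2 hθ
    | succ d ih =>
      intro v hv hd
      have h2 := hlab v
      have h3 := h₀ v
      rcases hθ : f₀ v with _ | _ | (i | i | ⟨j, k⟩ | l)
      · exact absurd hθ hv
      · exact (hret' v).2 hθ
      · exact (hs' v i).2 hθ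
      · exact (ht' v i).2 hθ
      · rw [hθ] at h2 h3
        obtain ⟨hk, u, hu1, hu, hvu, hσ⟩ := h3
        have hvis : C.Visits (σ₀ v).1 := by
          have := h2.1
          rw [hvu] at this
          rw [hσ]
          exact this
        have hne : f₀ (σ₀ v) ≠ .stay := fun h' => by
          have := hlab (σ₀ v)
          rw [h'] at this
          exact this hvis
        have h4 := ih (σ₀ v) hne (by
          rw [hvu] at hd
          rw [hσ]
          simp only at hd ⊢
          omega)
        obtain ⟨x, hx⟩ := σ.surjective (σ₀ v)
        have h5 := h x
        rw [hx, hσ] at h5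
        have hk1 := (mem_Icc.1 k.2).1
        rcases hθ' : f x with _ | _ | (i | i | ⟨j', k'⟩ | l)
        · exfalso
          rw [hθ'] at h5
          have : σ₀ v = x := Subtype.ext (hσ.trans h5)
          rw [← h4, this] at hne
          exact hne hθ'
        · rw [hθ'] at h5
          obtain ⟨_, -, -, -, h6⟩ := h5
          simp only [Prod.mk.injEq] at h6
          omega
        · rw [hθ'] at h5
          obtain ⟨_, -, -, -, h6⟩ := h5
          simp only [Prod.mk.injEq] at h6
          omega
        · rw [hθ'] at h5
          obtain ⟨_, -, -, -, h6⟩ := h5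
          simp only [Prod.mk.injEq] at h6
          omega
        · rw [hθ'] at h5
          obtain ⟨-, u', -, -, h6, h7⟩ := h5
          simp only [Prod.mk.injEq] at h7
          obtain rfl : j = j' := Subtype.ext h7.2.1
          obtain rfl : k = k' := Subtype.ext (by omega)
          have : x = v := Subtype.ext (by rw [h6, hvu, h7.1])
          rw [← this, hθ']
        · rw [hθ'] at h5
          obtain ⟨_, -, -, -, h6⟩ := h5
          simp only [Prod.mk.injEq] at h6
          omega
      · exact (hz' v l).2 hθ
  have hstay : (univ.filter fun v => f v = .stay) = univ.filter fun v => f₀ v = .stay := by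
    refine eq_of_subset_of_card_le (fun v hv => ?_) (hcard _).ge
    simp only [mem_filter, mem_univ, true_and] at hv ⊢
    by_contra hne
    exact hne ((hvis _ v hne rfl).symm.trans hv)
  have hf : f = f₀ := by
    funext v
    by_cases hv : f₀ v = .stay
    · rw [hv]
      simpa [hv] using Finset.ext_iff.1 hstay v
    · exact hvis _ v hv rfl
  subst hf
  exact ⟨Equiv.ext fun v => Subtype.ext (isStep_unique (h v) (h₀ v)), rfl⟩

end PathSystem

/-! ### The path system of a `U`-chain -/

section UTuple

variable {n : ℕ} {P : n.Partition} {s : ℕ} {a : Fin s → ℕ}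

theorem IsUTuple.add_two_mul_le (ha : IsUTuple P a) {i j : Fin s} (h : i ≤ j) :
    a j + 2 * (j - i : ℕ) ≤ a i := by
  have key : ∀ (d i : ℕ) (h : i + d < s), a ⟨i + d, h⟩ + 2 * d ≤ a ⟨i, by omega⟩ := by
    intro d
    induction d with
    | zero => intro i h; simp
    | succ d ih =>
      intro i h
      have h1 := ih i (by omega)
      have h2 := ha.2 (i + d) h
      have h3 : a ⟨i + (d + 1), h⟩ = a ⟨i + d + 1, h⟩ := rfl
      omega
  have h1 := key (j - i : ℕ) i (by have := Fin.le_def.1 h; omega)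
  have h2 : (⟨(i : ℕ) + (j - i : ℕ), by have := Fin.le_def.1 h; omega⟩ : Fin s) = j := by
    ext
    have := Fin.le_def.1 h
    simp only
    omega
  rw [h2] at h1
  exact h1

theorem IsUTuple.add_two_le (ha : IsUTuple P a) {i j : Fin s} (h : i < j) : a j + 2 ≤ a i := by
  have := ha.add_two_mul_le h.le
  have := Fin.lt_def.1 h
  omega

theorem IsUTuple.eq_of_le_of_lt (ha : IsUTuple P a) {i j : Fin s} (h : a i ≤ a j)
    (h' : a j < a i + 2) : i = j := by
  rcases lt_trichotomy i j with h1 | h1 | h1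
  · have := ha.add_two_le h1
    omega
  · exact h1
  · have := ha.add_two_le h1
    omega

/-- The rows `u ≤ #{i | a_i < l}` and `u > l - #{i | a_i < l}` of level `l` are disjoint. -/
theorem IsUTuple.two_mul_numBelow_le (ha : IsUTuple P a) (l : ℕ) : 2 * numBelow a l ≤ l := by
  have h : numBelow a l ≤ (Icc 1 (l / 2)).card := by
    -- Entries that differ by at least two have different halves.
    refine card_le_card_of_injOn (fun i => (a i + 1) / 2) ?_ ?_
    · intro i hi
      simp only [coe_filter, mem_univ, true_and, Set.mem_ofPred_eq] at hi
      have := pos_of_mem_levels P (ha.1 i)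
      simp only [coe_Icc, Set.mem_Icc]
      omega
    · intro i _ j _ hij
      simp only at hij
      rcases le_total (a i) (a j) with h | h
      · exact ha.eq_of_le_of_lt h (by omega)
      · exact (ha.eq_of_le_of_lt h (by omega)).symm
  rw [Nat.card_Icc] at h
  omega

theorem numBelow_succ_of_forall_ne {l : ℕ} (h : ¬ ∃ i, a i = l) :
    numBelow a (l + 1) = numBelow a l := by
  refine congrArg card (filter_congr fun i _ => ?_)
  have : a i ≠ l := fun hi => h ⟨i, hi⟩
  omega

theorem IsUTuple.numBelow_succ (ha : IsUTuple P a) {l : ℕ} (h : ∃ i, a i = l) :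
    numBelow a (l + 1) = numBelow a l + 1 := by
  obtain ⟨i, rfl⟩ := h
  rw [numBelow, numBelow, ← card_insert_of_notMem (a := i) (by simp)]
  refine congrArg card (Finset.ext fun j => ?_)
  simp only [mem_filter, mem_univ, true_and, mem_insert]
  constructor
  · intro h
    rcases Nat.lt_or_ge (a j) (a i) with h' | h'
    · exact Or.inr h'
    · exact Or.inl (ha.eq_of_le_of_lt h' (by omega)).symm
  · rintro (rfl | h) <;> omega

open Classical in
/-- The `U`-chain of a tuple is the set of vertices of a path system, provided that at each `a_i`
the path of `a_i` can step to the next row, by way of the level `a_i - 1` or along `w_{a_i}`. -/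
theorem IsUTuple.exists_pathSystem (ha : IsUTuple P a)
    (hgood : ∀ i, a i - 1 ∈ levels P ∨ a i ∈ oddMinima P) :
    ∃ C : PathSystem P s, ∀ v ∈ vertices P, C.Visits v ↔ v ∈ uChain P a := by
  have hnot : ∀ l, (∃ i, a i = l) → ¬ ∃ i, a i = l + 1 := by
    rintro l ⟨i, hi⟩ ⟨j, hj⟩
    have := ha.eq_of_le_of_lt (i := i) (j := j) (by omega) (by omega)
    subst this
    omega
  let C : PathSystem P s := {
    down := fun l => if (∃ i, a i = l) ∧ l - 1 ∈ levels P then l - (numBelow a l + 1)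
      else numBelow a l
    up := fun l => if ∃ i, a i = l + 1 then l - numBelow a l else numBelow a (l + 1)
    full := fun l => ∃ i, a i = l
    up_pred := fun i hi => by
      have hp := pred_mem P hi
      have hlt := pred_lt P hi
      by_cases h : ∃ r, a r = pred P i + 1
      · have h1 : i = pred P i + 1 := by
          obtain ⟨r, hr⟩ := h
          by_contra hne
          have h2 := ha.1 r
          rw [hr] at h2
          have := le_pred (i := i) P h2 (by omega)
          omega
        rw [if_pos h, if_pos ⟨by rw [h1]; exact h, by
          rw [show i - 1 = pred P i by omega]
          exact hp⟩]
        have h3 := numBelow_succ_of_forall_ne fun h' => hnot _ h' h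
        rw [← h1] at h3
        omega
      · rw [if_neg h, if_neg]
        · refine congrArg card (filter_congr fun r _ => ?_)
          constructor
          · intro h'
            omega
          · intro h'
            have := le_pred P (ha.1 r) h'
            omega
        · rintro ⟨⟨r, hr⟩, hl⟩
          have := le_pred (i := i) P hl (by omega)
          exact h ⟨r, by omega⟩
    up_top := by
      have htop : ∀ i, a i ≤ topLevel P := fun i => le_topLevel P (ha.1 i)
      rw [if_neg]
      · rw [numBelow, filter_true_of_mem fun i _ => Nat.lt_succ_of_le (htop i)]
        simp
      · rintro ⟨r, hr⟩
        have := htop r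
        omega
    down_eq_zero := fun l hl hl' => by
      have hmin : ∀ j ∈ levels P, l ≤ j := fun j hj => by
        by_contra h
        exact hl' (mem_filter.2 ⟨hl, j, hj, not_le.1 h⟩)
      have hpos := pos_of_mem_levels P hl
      rw [if_neg]
      · rw [numBelow, card_eq_zero, filter_eq_empty_iff]
        intro i _
        have := hmin _ (ha.1 i)
        omega
      · rintro ⟨-, h⟩
        have := hmin _ h
        omega
    add_le := fun l hl => by
      have h2 := ha.two_mul_numBelow_le l
      by_cases hf : ∃ i, a i = l
      · have h1 := ha.numBelow_succ hf
        have hpos := pos_of_mem_levels P hl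
        -- No entry of the tuple equals `l - 1`, so the entries below `l` are below `l - 1`.
        have h3 : numBelow a (l - 1 + 1) = numBelow a (l - 1) := by
          refine numBelow_succ_of_forall_ne fun h => hnot _ h ?_
          rwa [Nat.sub_add_cancel hpos]
        rw [Nat.sub_add_cancel hpos] at h3
        have h4 := ha.two_mul_numBelow_le (l - 1)
        rw [if_neg (hnot l hf)]
        split_ifs <;> omega
      · have h1 := numBelow_succ_of_forall_ne hf
        rw [if_neg fun h => hf h.1]
        split_ifs <;> omega
    of_not_full := fun l hl hf => by
      have h2 := ha.two_mul_numBelow_le l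
      have h1 := numBelow_succ_of_forall_ne hf
      rw [if_neg fun h => hf h.1]
      split_ifs <;> omega
    of_full := fun l hl hf => by
      have h2 := ha.two_mul_numBelow_le l
      have h1 := ha.numBelow_succ hf
      have hpos := pos_of_mem_levels P hl
      rw [if_neg (hnot l hf)]
      by_cases h : l - 1 ∈ levels P
      · rw [if_pos ⟨hf, h⟩]
        omega
      · rw [if_neg fun h' => h h'.2]
        obtain ⟨i, rfl⟩ := hf
        exact Or.inr ⟨h1, (hgood i).resolve_left h⟩ }
  refine ⟨C, fun v hv => ?_⟩
  have hb := (mem_vertices_iff P v).1 hv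
  obtain ⟨u, l, m⟩ := v
  have h2 := ha.two_mul_numBelow_le l
  simp only at hb
  rw [uChain, mem_filter]
  simp only [hv, true_and, PathSystem.Visits, C]
  by_cases hf : ∃ i, a i = l
  · exact iff_of_true (Or.inr (Or.inr hf)) (Or.inl (hf.imp fun i hi => Or.inl hi.symm))
  · have h1 := numBelow_succ_of_forall_ne hf
    rw [if_neg fun h => hf h.1]
    by_cases hs : ∃ i, a i = l + 1
    · rw [if_pos hs]
      refine iff_of_true ?_ (Or.inl (hs.imp fun i hi => Or.inr hi.symm))
      omega
    · rw [if_neg hs, h1]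
      constructor
      · intro h
        have h0 : u ≤ numBelow a l ∨ l + 1 ≤ u + numBelow a l := by
          rcases h with h | h | h
          · omega
          · omega
          · exact absurd h hf
        refine Or.inr ⟨?_, h0⟩
        have h3 : 0 < numBelow a l := by omega
        obtain ⟨i, hi⟩ := card_pos.1 h3
        exact ⟨i, (mem_filter.1 hi).2⟩
      · rintro (⟨i, h | h⟩ | ⟨-, h⟩)
        · exact absurd ⟨i, h.symm⟩ hf
        · exact absurd ⟨i, h.symm⟩ hs
        · omega

/-! ### Enlarging a `U`-chain -/

/-- A level that starts a maximal run of consecutive levels, but is not in `S_P''`, starts a run of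
even length. -/
theorem exists_even_run {x : ℕ} (hx : x ∈ levels P) (hx' : x - 1 ∉ levels P)
    (hodd : x ∉ oddMinima P) :
    ∃ b, x ≤ b ∧ Icc x b ⊆ levels P ∧ b + 1 ∉ levels P ∧ Even (b + 1 - x) := by
  classical
  have hne : ((levels P).filter fun b => x ≤ b ∧ Icc x b ⊆ levels P).Nonempty :=
    ⟨x, mem_filter.2 ⟨hx, le_rfl, by simpa using hx⟩⟩
  set b := max' _ hne with hb
  obtain ⟨-, hxb, hsub⟩ := mem_filter.1 (max'_mem _ hne)
  rw [← hb] at hxb hsub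
  have hb1 : b + 1 ∉ levels P := fun h => by
    have : b + 1 ≤ b := le_max' _ _ (mem_filter.2 ⟨h, by omega, fun y hy => by
      rw [mem_Icc] at hy
      rcases hy.2.lt_or_eq with h1 | h1
      · exact hsub (mem_Icc.2 ⟨hy.1, by omega⟩)
      · rw [h1]
        exact h⟩)
    omega
  refine ⟨b, hxb, hsub, hb1, ?_⟩
  rw [← Nat.not_odd_iff_even]
  intro h
  refine hodd (mem_filter.2 ⟨hx, Icc x b, ⟨⟨hsub, x, b, hxb, rfl⟩, ?_⟩, by simpa using h, ?_⟩)
  · rintro D ⟨hD, c, e, -, rfl⟩ hle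
    have hx1 := mem_Icc.1 (hle (mem_Icc.2 ⟨le_rfl, hxb⟩))
    have hb2 := mem_Icc.1 (hle (mem_Icc.2 ⟨hxb, le_rfl⟩))
    refine Icc_subset_Icc ?_ ?_
    · by_contra hc
      exact hx' (hD (mem_Icc.2 (by omega)))
    · by_contra hc
      exact hb1 (hD (mem_Icc.2 (by omega)))
  · simp only [coe_Icc]
    exact isLeast_Icc hxb

/-- If `a_i` starts an even run of levels, then the entries `a_i, a_i + 2, …` of the tuple can be
raised by one, which enlarges the `U`-chain. -/
theorem IsUTuple.exists_raise (ha : IsUTuple P a) (i : Fin s) (hi : a i - 1 ∉ levels P)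
    (hi' : a i ∉ oddMinima P) :
    ∃ a' : Fin s → ℕ, IsUTuple P a' ∧ uChain P a ⊆ uChain P a' ∧ ∑ r, a r < ∑ r, a' r := by
  obtain ⟨b, hxb, hsub, hb1, heven⟩ := exists_even_run (ha.1 i) hi hi'
  set p : Fin s → Prop := fun r => r ≤ i ∧ a r = a i + 2 * (i - r : ℕ) with hp
  -- The entries to be raised lie in the run of `a i`; its length being even, so do the raised ones.
  have hrun : ∀ (d : ℕ) (r : Fin s), (i : ℕ) = r + d → a r = a i + 2 * d → a i + 2 * d + 1 ≤ b := by
    intro d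
    induction d with
    | zero =>
      -- The run `Icc (a i) b` has even length, so it does not consist of `a i` alone.
      intro r _ _
      obtain ⟨c, hc⟩ := heven
      omega
    | succ d ih =>
      intro r hr hd
      have hlt : (r : ℕ) + 1 < s := by have := i.2; omega
      have h1 := ha.add_two_mul_le (i := ⟨r + 1, hlt⟩) (j := i) (Fin.le_def.2 (by simp only; omega))
      have h2 := ha.2 r hlt
      simp only [Fin.eta] at h1 h2
      have h3 := ih ⟨r + 1, hlt⟩ (by simp only; omega) (by omega)
      have h4 : a r ≠ b + 1 := fun h => hb1 (h ▸ ha.1 r)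
      obtain ⟨c, hc⟩ := heven
      omega
  obtain ⟨a', hpos, hneg⟩ : ∃ a' : Fin s → ℕ, (∀ r, p r → a' r = a r + 1) ∧
      ∀ r, ¬ p r → a' r = a r := by
    classical
    exact ⟨fun r => if p r then a r + 1 else a r, fun r h => if_pos h, fun r h => if_neg h⟩
  refine ⟨a', ⟨fun r => ?_, fun r hr => ?_⟩, fun v hv => ?_, ?_⟩
  · by_cases h : p r
    · rw [hpos r h]
      have h1 := Fin.le_def.1 h.1
      have h2 := hrun (i - r : ℕ) r (by omega) h.2
      exact hsub (mem_Icc.2 (by omega))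
    · rw [hneg r h]
      exact ha.1 r
  · have h1 := ha.2 r hr
    by_cases hpr : p ⟨r + 1, hr⟩
    · have h2 := Fin.le_def.1 hpr.1
      have h3 := hpr.2
      simp only at h2 h3
      by_cases hpr' : p ⟨r, by omega⟩
      · rw [hpos _ hpr, hpos _ hpr']
        omega
      · rw [hpos _ hpr, hneg _ hpr']
        have h4 : a ⟨r, by omega⟩ ≠ a i + 2 * (i - r : ℕ) := fun h =>
          hpr' ⟨Fin.le_def.2 (by simp only; omega), h⟩
        omega
    · rw [hneg _ hpr]
      by_cases hpr' : p ⟨r, by omega⟩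
      · rw [hpos _ hpr']
        omega
      · rw [hneg _ hpr']
        exact h1
  · obtain ⟨hv, h⟩ := mem_filter.1 hv
    have hb := (mem_vertices_iff P v).1 hv
    refine mem_filter.2 ⟨hv, ?_⟩
    rcases h with ⟨j, h | h⟩ | ⟨⟨j, hj⟩, h⟩
    · left
      refine ⟨j, ?_⟩
      by_cases hpj : p j
      · rw [hpos j hpj]
        exact Or.inr (by omega)
      · rw [hneg j hpj]
        exact Or.inl h
    · left
      by_cases hpj : p j
      · have hji : j ≠ i := by
          rintro rfl
          refine hi ?_
          rw [← h, Nat.add_sub_cancel]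
          exact hb.1
        have h1 := Fin.lt_def.1 (lt_of_le_of_ne hpj.1 hji)
        have h2 := hpj.2
        have hlt : (j : ℕ) + 1 < s := by have := i.2; omega
        have h3 := ha.add_two_mul_le (i := ⟨j + 1, hlt⟩) (j := i)
          (Fin.le_def.2 (by simp only; omega))
        have h4 := ha.2 j hlt
        simp only [Fin.eta] at h3 h4
        refine ⟨⟨j + 1, hlt⟩, ?_⟩
        rw [hpos _ ⟨Fin.le_def.2 (by simp only; omega), by simp only; omega⟩]
        omega
      · exact ⟨j, by rw [hneg j hpj]; exact Or.inr h⟩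
    · by_cases hex : ∃ r, p r ∧ v.2.1 = a r + 1
      · obtain ⟨r, hpr, hr⟩ := hex
        exact Or.inl ⟨r, by rw [hpos r hpr]; exact Or.inl hr⟩
      · have hbelow : ∀ r, a r < v.2.1 → a' r < v.2.1 := by
          intro r hr
          by_cases hpr : p r
          · rw [hpos r hpr]
            have : v.2.1 ≠ a r + 1 := fun h => hex ⟨r, hpr, h⟩
            omega
          · rw [hneg r hpr]
            exact hr
        have hle : numBelow a v.2.1 ≤ numBelow a' v.2.1 :=
          card_le_card fun r hr => mem_filter.2 ⟨mem_univ _, hbelow r (mem_filter.1 hr).2⟩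
        exact Or.inr ⟨⟨j, hbelow j hj⟩, by omega⟩
  · refine sum_lt_sum (fun r _ => ?_) ⟨i, mem_univ _, ?_⟩
    · by_cases hpr : p r
      · rw [hpos r hpr]
        omega
      · exact (hneg r hpr).ge
    · rw [hpos i ⟨le_rfl, by simp⟩]
      omega

/-- Every `U`-chain is contained in one whose tuple meets the condition of
`IsUTuple.exists_pathSystem`. -/
theorem IsUTuple.exists_good (ha : IsUTuple P a) : ∃ a' : Fin s → ℕ, IsUTuple P a' ∧
    uChain P a ⊆ uChain P a' ∧ ∀ i, a' i - 1 ∈ levels P ∨ a' i ∈ oddMinima P := by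
  classical
  obtain ⟨a', ha', hmax⟩ := exists_max_image ((Fintype.piFinset fun _ : Fin s => levels P).filter
    fun a' => IsUTuple P a' ∧ uChain P a ⊆ uChain P a') (fun a' => ∑ r, a' r)
    ⟨a, mem_filter.2 ⟨Fintype.mem_piFinset.2 ha.1, ha, Subset.rfl⟩⟩
  obtain ⟨-, hU, hsub⟩ := mem_filter.1 ha'
  refine ⟨a', hU, hsub, fun i => ?_⟩
  by_contra hbad
  rw [not_or] at hbad
  obtain ⟨a'', hU', hsub', hlt⟩ := hU.exists_raise i hbad.1 hbad.2
  have := hmax a'' (mem_filter.2 ⟨Fintype.mem_piFinset.2 hU'.1, hU', hsub.trans hsub'⟩)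
  omega

end UTuple

/-! ### Nilpotency -/

theorem mulVecLin_pow_eq_zero {K ι : Type*} [Field K] [Fintype ι] (A : Matrix ι ι K)
    (ρ : ι → ℕ) (hρ : ∀ v' v, A v' v ≠ 0 → ρ v < ρ v') : ∃ m, A.mulVecLin ^ m = 0 := by
  classical
  have key : ∀ j v' v, (A ^ j) v' v ≠ 0 → ρ v + j ≤ ρ v' := by
    intro j
    induction j with
    | zero =>
      intro v' v h
      rw [pow_zero, Matrix.one_apply] at h
      have : v' = v := by
        by_contra hne
        exact h (if_neg hne)
      simp [this]
    | succ j ih =>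
      intro v' v h
      rw [pow_succ', Matrix.mul_apply] at h
      obtain ⟨w, -, hw⟩ := exists_ne_zero_of_sum_ne_zero h
      have h1 := hρ _ _ (left_ne_zero_of_mul hw)
      have h2 := ih _ _ (right_ne_zero_of_mul hw)
      omega
  refine ⟨univ.sup ρ + 1, ?_⟩
  have h0 : A ^ (univ.sup ρ + 1) = 0 := by
    funext v' v
    by_contra h
    have h1 := key _ _ _ h
    have h2 : ρ v' ≤ univ.sup ρ := le_sup (mem_univ v')
    omega
  have h1 := Matrix.toLin'_pow A (univ.sup ρ + 1)
  rw [h0, map_zero] at h1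
  exact h1.symm

/-- Every edge increases the vertices lexicographically, first by `2u - l` and then by the position
in the row. -/
theorem simplyAdequateFrac_pow_eq_zero {n : ℕ} (P : n.Partition) (k : Type*) [Field k] :
    ∃ m, (simplyAdequateFrac P k).mulVecLin ^ m = 0 := by
  classical
  have hlex : ∀ x x' m m' : ℕ, x < x' → m ≤ P.parts.card → 1 ≤ m' →
      x * (P.parts.card + 1) + m < x' * (P.parts.card + 1) + m' := by
    intro x x' m m' hx hm hm'
    have : (x + 1) * (P.parts.card + 1) ≤ x' * (P.parts.card + 1) := Nat.mul_le_mul_right _ hx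
    rw [Nat.succ_mul] at this
    omega
  have hmult : ∀ l, mult P l ≤ P.parts.card := fun l => Multiset.count_le_card _ _
  refine mulVecLin_pow_eq_zero _
    (fun v => (2 * v.1.1 + topLevel P - v.1.2.1) * (P.parts.card + 1) + v.1.2.2) ?_
  intro v' v h
  have hA : simplyAdequate P k v' v ≠ 0 := fun h0 => h (by
    rw [simplyAdequateFrac, Matrix.map_apply, h0, map_zero])
  rw [simplyAdequate_apply P 0] at hA
  obtain ⟨τ, -, hτ⟩ := exists_ne_zero_of_sum_ne_zero hA
  have hstep : IsStep P 0 (.edge τ) v.1 v'.1 := by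
    by_contra hn
    exact hτ (if_neg hn)
  have hv := le_topLevel P v.bounds.1
  have hv' := le_topLevel P v'.bounds.1
  rcases τ with i | i | ⟨j, m⟩ | l
  · obtain ⟨u, hu1, hu, h1, h2⟩ := hstep
    rw [h1] at hv ⊢
    rw [h2] at hv' ⊢
    have := pred_lt P i.2
    simp only at hv hv' ⊢
    exact hlex _ _ _ _ (by omega) (hmult _) le_rfl
  · obtain ⟨u, hu1, hu, h1, h2⟩ := hstep
    rw [h1] at hv ⊢
    rw [h2] at hv' ⊢
    have := pred_lt P i.2
    simp only at hv hv' ⊢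
    exact hlex _ _ _ _ (by omega) (hmult _) le_rfl
  · obtain ⟨-, u, hu1, hu, h1, h2⟩ := hstep
    rw [h1, h2]
    simp only
    omega
  · obtain ⟨u, hu1, hu, h1, h2⟩ := hstep
    rw [h1] at hv ⊢
    rw [h2] at hv' ⊢
    simp only at hv hv' ⊢
    exact hlex _ _ _ _ (by omega) (hmult _) le_rfl

/-! ### Jordan type and `U`-chains -/

open Classical in
/-- The exponents of a monomial determine how often each label is used; for the return steps, which
have weight `0`, this follows from the total number of vertices. -/
theorem card_filter_eq_of_sum_weight_eq {n : ℕ} {P : n.Partition} {f g : Vertex P → Step P}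
    (h1 : ∑ v, stayWeight (f v) = ∑ v, stayWeight (g v))
    (h2 : ∑ v, edgeWeight (f v) = ∑ v, edgeWeight (g v)) (θ : Step P) :
    (univ.filter fun v => f v = θ).card = (univ.filter fun v => g v = θ).card := by
  have hstay : ∀ f : Vertex P → Step P,
      ∑ v, stayWeight (f v) = (univ.filter fun v => f v = .stay).card := by
    intro f
    rw [card_filter]
    refine sum_congr rfl fun v _ => ?_
    cases f v <;> simp [stayWeight]
  have hedge : ∀ (f : Vertex P → Step P) τ,
      (∑ v, edgeWeight (f v)) τ = (univ.filter fun v => f v = .edge τ).card := by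
    intro f τ
    rw [card_filter, Finsupp.finsetSum_apply]
    refine sum_congr rfl fun v _ => ?_
    cases f v <;> simp [edgeWeight, Finsupp.single_apply]
  have e1 : (univ.filter fun v => f v = .stay).card = (univ.filter fun v => g v = .stay).card := by
    rw [← hstay, ← hstay, h1]
  have e2 : ∀ τ, (univ.filter fun v => f v = .edge τ).card =
      (univ.filter fun v => g v = .edge τ).card := fun τ => by rw [← hedge, ← hedge, h2]
  have htot : ∀ f : Vertex P → Step P, (univ.filter fun v => f v = .stay).card +
      ((univ.filter fun v => f v = .ret).card + ∑ τ, (univ.filter fun v => f v = .edge τ).card) =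
      Fintype.card (Vertex P) := by
    intro f
    rw [← sum_step P fun θ => (univ.filter fun v => f v = θ).card, ← card_univ]
    exact (card_eq_sum_card_fiberwise fun v _ => mem_coe.2 (mem_univ (f v))).symm
  rcases θ with _ | _ | τ
  · exact e1
  · have t1 := htot f
    have t2 := htot g
    rw [e1, sum_congr rfl fun τ _ => e2 τ] at t1
    omega
  · exact e2 τ

/-- A lower bound for the sum of the `s` largest parts of the Jordan type, read off from the
characteristic polynomial of a perturbation of rank at most `s`. -/
theorem HasJordanType.card_le_natTrailingDegree_add {K ι : Type*} [Field K] [Fintype ι]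
    [DecidableEq ι] {A : Matrix ι ι K} {n : ℕ} {Q : n.Partition} (hA : HasJordanType A Q) {m : ℕ}
    (hm : A.mulVecLin ^ m = 0) (R : Matrix ι ι K) (s : ℕ)
    (hR : Module.finrank K (LinearMap.range R.mulVecLin) ≤ s) :
    (Fintype.card ι : ℤ) ≤ (-(A + R)).charpoly.natTrailingDegree + ∑ j ∈ Icc 1 s, part Q j := by
  have h1 := finrank_le_natTrailingDegree_add A.mulVecLin R.mulVecLin m hm
  have hneg : -(A.mulVecLin + R.mulVecLin) = Matrix.toLin' (-(A + R)) := by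
    rw [map_neg, map_add]
    rfl
  rw [hneg, Matrix.charpoly_toLin', Module.finrank_fintype_fun_eq_card] at h1
  have h2 := hA.finrank_orbitSpan_le m hm _ s hR
  omega

theorem finrank_range_returnMatrix_le {n : ℕ} (P : n.Partition) (s : ℕ) (K : Type*) [Field K] :
    Module.finrank K (LinearMap.range (returnMatrix P s K).mulVecLin) ≤ s := by
  classical
  set T : Finset (Vertex P) := univ.filter fun v' => ∃ v : Vertex P, IsStep P s .ret v.1 v'.1
  have hT : T.card ≤ (Icc 1 s).card := by
    refine card_le_card_of_injOn (fun v => v.1.1) (fun v hv => ?_) fun v hv w hw hvw => ?_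
    · obtain ⟨w, u, hu, hus, -, h⟩ := (mem_filter.1 (mem_coe.1 hv)).2
      simp only [h, coe_Icc, Set.mem_Icc]
      omega
    · obtain ⟨-, u, -, -, -, h⟩ := (mem_filter.1 (mem_coe.1 hv)).2
      obtain ⟨-, u', -, -, -, h'⟩ := (mem_filter.1 (mem_coe.1 hw)).2
      simp only [h, h'] at hvw
      exact Subtype.ext (by rw [h, h', hvw])
  rw [Nat.card_Icc, Nat.add_sub_cancel] at hT
  refine (finrank_le_card_of_support T ?_).trans hT
  rintro _ ⟨x, rfl⟩ v' hv'
  rw [Matrix.mulVecLin_apply, Matrix.mulVec, dotProduct]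
  refine sum_eq_zero fun v _ => ?_
  rw [returnMatrix, edgeMatrix, Matrix.of_apply, if_neg, zero_mul]
  exact fun h => hv' (mem_filter.2 ⟨mem_univ _, v, h⟩)

theorem map_returnMatrix {n : ℕ} (P : n.Partition) (s : ℕ) {R S : Type*} [Semiring R] [Semiring S]
    (φ : R →+* S) : (returnMatrix P s R).map φ = returnMatrix P s S := by
  funext v' v
  simp only [returnMatrix, edgeMatrix, Matrix.map_apply, Matrix.of_apply]
  split_ifs <;> simp

open Classical in
/-- The vertices not visited by a path system bound the order of vanishing at `0` of the
characteristic polynomial of `-(A_R + returnMatrix)`: the coefficient of the monomial belonging to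
the path system is `±1`. -/
theorem PathSystem.natTrailingDegree_le {n : ℕ} {P : n.Partition} {s : ℕ} (C : PathSystem P s)
    {k K : Type*} [Field k] [Field K] (φ : PolyRing P k →+* K) (hφ : Function.Injective φ) :
    (-((simplyAdequate P k).map φ + returnMatrix P s K)).charpoly.natTrailingDegree ≤
      ((vertices P).filter fun v => ¬ C.Visits v).card := by
  obtain ⟨σ₀, f₀, hlab, h₀⟩ := C.exists_perm
  have hcoeff := coeff_coeff_det_ne_zero (k := k) (fun θ (v v' : Vertex P) => IsStep P s θ v.1 v'.1)
    stayWeight edgeWeight σ₀ f₀ h₀ fun σ f h h1 h2 =>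
      C.unique hlab h₀ h (card_filter_eq_of_sum_weight_eq h1 h2)
  rw [← charmatrix_eq] at hcoeff
  have hstay : ∑ v, stayWeight (f₀ v) = ((vertices P).filter fun v => ¬ C.Visits v).card := by
    have : ∀ v : Vertex P, stayWeight (f₀ v) = if ¬ C.Visits v.1 then 1 else 0 := by
      intro v
      have h := hlab v
      by_cases hv : C.Visits v.1
      · rw [if_neg (not_not.2 hv)]
        rcases hθ : f₀ v with _ | _ | τ
        · rw [hθ] at h
          exact absurd hv h
        · rfl
        · rfl
      · rw [if_pos hv, C.isLabel_unique v.2 h (θ' := .stay) hv]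
        rfl
    rw [sum_congr rfl fun v _ => this v,
      sum_coe_sort (vertices P) (fun v => if ¬ C.Visits v then 1 else 0), ← card_filter]
  have hmap : -((simplyAdequate P k).map φ + returnMatrix P s K) =
      (-(simplyAdequate P k + returnMatrix P s (PolyRing P k))).map φ := by
    rw [← map_returnMatrix P s φ]
    funext v' v
    simp
  rw [← hstay, hmap]
  refine Polynomial.natTrailingDegree_le_of_ne_zero ?_
  rw [Matrix.charpoly_map, Polynomial.coeff_map, map_ne_zero_iff φ hφ]
  exact fun h0 => hcoeff ((congrArg (MvPolynomial.coeff _) h0).trans (MvPolynomial.coeff_zero _))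

open Classical in
theorem PathSystem.card_visits_le {n : ℕ} {P : n.Partition} {s : ℕ} (C : PathSystem P s)
    {k : Type*} [Field k] {Q : n.Partition} (hQ : HasJordanType (simplyAdequateFrac P k) Q) :
    (((vertices P).filter C.Visits).card : ℤ) ≤ ∑ j ∈ Icc 1 s, part Q j := by
  obtain ⟨m, hm⟩ := simplyAdequateFrac_pow_eq_zero P k
  have h1 := hQ.card_le_natTrailingDegree_add hm (returnMatrix P s _) s
    (finrank_range_returnMatrix_le P s _)
  have h2 := C.natTrailingDegree_le (algebraMap (PolyRing P k) (FractionRing (PolyRing P k)))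
    (IsFractionRing.injective _ _)
  have h3 := card_filter_add_card_filter_not (s := vertices P) C.Visits
  rw [simplyAdequateFrac, Fintype.card_coe] at h1
  omega

theorem IsUTuple.card_uChain_le {n : ℕ} {P : n.Partition} {s : ℕ} {a : Fin s → ℕ}
    (ha : IsUTuple P a) {k : Type*} [Field k] {Q : n.Partition}
    (hQ : HasJordanType (simplyAdequateFrac P k) Q) :
    ((uChain P a).card : ℤ) ≤ ∑ j ∈ Icc 1 s, part Q j := by
  classical
  obtain ⟨a', ha', hsub, hgood⟩ := ha.exists_good
  obtain ⟨C, hC⟩ := ha'.exists_pathSystem hgood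
  refine le_trans ?_ (C.card_visits_le hQ)
  rw [Nat.cast_le]
  refine card_le_card (hsub.trans fun v hv => ?_)
  have hv' := (mem_filter.1 hv).1
  exact mem_filter.2 ⟨hv', (hC v hv').2 hv⟩

theorem part_nonneg {n : ℕ} (Q : n.Partition) (j : ℕ) : 0 ≤ part Q j := Nat.cast_nonneg _

open Classical in
theorem uMax_le {n : ℕ} {P : n.Partition} {k : Type*} [Field k] {Q : n.Partition}
    (hQ : HasJordanType (simplyAdequateFrac P k) Q) (s : ℕ) :
    (uMax P s : ℤ) ≤ ∑ j ∈ Icc 1 s, part Q j := by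
  have h0 : 0 ≤ ∑ j ∈ Icc 1 s, part Q j := sum_nonneg fun j _ => part_nonneg Q j
  rw [← Int.toNat_of_nonneg h0, Nat.cast_le, uMax]
  refine Finset.sup_le fun a ha => ?_
  have := (mem_filter.1 ha).2.card_uChain_le hQ
  omega

theorem uMax_zero {n : ℕ} (P : n.Partition) : uMax P 0 = 0 := by
  refine Nat.le_zero.1 (Finset.sup_le fun a _ => ?_)
  simp [uChain]

theorem sum_lambdaU {n : ℕ} (P : n.Partition) (i : ℕ) :
    ∑ j ∈ Icc 1 i, lambdaU P j = uMax P (min i (rP P)) := by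
  induction i with
  | zero => simp [uMax_zero]
  | succ i ih =>
    rw [sum_Icc_succ_top (by omega), ih, lambdaU, Nat.add_sub_cancel]
    by_cases h : i + 1 ≤ rP P
    · rw [if_pos ⟨by omega, h⟩, min_eq_left h, min_eq_left (by omega)]
      ring
    · rw [if_neg fun h' => h h'.2, add_zero, min_eq_right (by omega), min_eq_right (by omega)]

end JordanPoset

theorem corollary3p8 (k : Type*) [Field k] [Infinite k] (n : ℕ) (P : n.Partition) :
    (∃ Q : n.Partition, JordanPoset.HasJordanType (JordanPoset.simplyAdequateFrac P k) Q) ∧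
    ∀ Q : n.Partition, JordanPoset.HasJordanType (JordanPoset.simplyAdequateFrac P k) Q →
      JordanPoset.Dominates (JordanPoset.part Q) (JordanPoset.lambdaU P) := by
  refine ⟨?_, fun Q hQ i => ?_⟩
  · obtain ⟨m, hm⟩ := JordanPoset.simplyAdequateFrac_pow_eq_zero P k
    exact JordanPoset.exists_hasJordanType _ m hm
      ((Fintype.card_coe _).trans (JordanPoset.card_vertices P))
  · rw [JordanPoset.sum_lambdaU]
    refine (JordanPoset.uMax_le hQ _).trans ?_
    exact Finset.sum_le_sum_of_subset_of_nonneg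
      (Finset.Icc_subset_Icc_right (min_le_left _ _)) fun j _ _ => JordanPoset.part_nonneg Q j
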